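/- Let $\Omega\subset\mathbb R^3$ be a smooth domain (open and connected, lying near each boundary point on one side of a smooth hypersurface; not necessarily bounded) with compact boundary, let $\nu$ be its outward unit normal, and let $\beta=(0,0,1)$. For $B\ge 0$ and a real vector field $\mathbf A\in C^1(\overline\Omega;\mathbb R^3)$ put $$D_j=-i\partial_j+BA_j,\qquad \mathbf D=(D_1,D_2,D_3)=-i\nabla+B\mathbf A,\qquad \mathcal H=\mathbf D^2=D_1^2+D_2^2+D_3^2 .$$ Then there exists a constant $C>0$, depending only on $\Omega$, such that for all $B\ge 0$, all $\mathbf A\in C^1(\overline\Omega;\mathbb R^3)$, all $p_1,p_2\in[1,+\infty]$ and all $\psi\in C^\infty(\overline\Omega;\mathbb C)$ satisfying the magnetic Neumann condition $\nu\cdot\mathbf D\psi|_{\partial\Omega}=0$, $$\sum_{j,k=1}^3\|D_jD_k\psi\|_2^2\le C\Big\{B^2\|\psi\|_2^2+(1+B)\|\mathbf D\psi\|_2^2+\|\mathcal H\psi\|_2^2+B^2\|\operatorname{curl}\mathbf A-\beta\|_{2p_1}^2\|\psi\|_{2q_1}^2+B\,\|\operatorname{curl}\mathbf A-\beta\|_{p_2}\|\mathbf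 D\psi\|_{2q_2}^2\Big\},$$ where $\|\cdot\|_p$ is the norm of $L^p(\Omega)$ and $q_j$ is the conjugate exponent of $p_j$, i.e. $p_j^{-1}+q_j^{-1}=1$. Here $C^n(\overline\Omega)$ denotes the restrictions to $\overline\Omega$ of $C^n$ functions on $\mathbb R^3$, and both sides are read in $[0,+\infty]$ with $0\cdot\infty=0$. -/

import Mathlib

open MeasureTheory Set
open scoped ENNReal ContDiff Gradient

noncomputable section

namespace MagneticNeumann

/-- Euclidean three-space. -/
abbrev E3 : Type := EuclideanSpace ℝ (Fin 3)

/-- The partial derivative of `f` in the `j`-th coordinate direction. -/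
def partialDeriv {F : Type*} [NormedAddCommGroup F] [NormedSpace ℝ F]
    (j : Fin 3) (f : E3 → F) (x : E3) : F :=
  fderiv ℝ f x (EuclideanSpace.single j 1)

/-- `ρ` is a smooth defining function of `Ω` in the open neighbourhood `U` of `x`: its gradient does
not vanish at `x`, and inside `U` the set `Ω` is `{ρ < 0}`. -/
structure IsDefiningFunctionNear (Ω : Set E3) (x : E3) (U : Set E3) (ρ : E3 → ℝ) : Prop where
  isOpen : IsOpen U
  mem : x ∈ U
  contDiffOn : ContDiffOn ℝ ∞ ρ U
  gradient_ne_zero : ∇ ρ x ≠ 0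
  inter_eq : Ω ∩ U = {y ∈ U | ρ y < 0}

/-- A smooth domain: an open connected set that lies, near each of its boundary points, on one side
of a smooth hypersurface. It need not be bounded. -/
structure IsSmoothDomain (Ω : Set E3) : Prop where
  isOpen : IsOpen Ω
  isConnected : IsConnected Ω
  smooth_boundary : ∀ x ∈ frontier Ω, ∃ U ρ, IsDefiningFunctionNear Ω x U ρ

/-- `n` is the unit normal of `∂Ω` at the boundary point `x` that points out of `Ω`. -/
def IsOuterUnitNormal (Ω : Set E3) (x n : E3) : Prop :=
  x ∈ frontier Ω ∧ ∃ U ρ, IsDefiningFunctionNear Ω x U ρ ∧ n = ‖∇ ρ x‖⁻¹ • ∇ ρ x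

/-- The magnetic derivative `D_j = -i ∂_j + B A_j`. -/
def magDeriv (B : ℝ) (A : E3 → E3) (j : Fin 3) (f : E3 → ℂ) (x : E3) : ℂ :=
  -Complex.I * partialDeriv j f x + (B : ℂ) * (A x j : ℂ) * f x

/-- The magnetic gradient `𝐃f = (D_1 f, D_2 f, D_3 f)`, with values in Hermitian `ℂ³`. -/
def magGrad (B : ℝ) (A : E3 → E3) (f : E3 → ℂ) (x : E3) : EuclideanSpace ℂ (Fin 3) :=
  WithLp.toLp 2 fun j => magDeriv B A j f x

/-- The magnetic Laplacian `𝓗 = D_1² + D_2² + D_3²`. -/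
def magLaplacian (B : ℝ) (A : E3 → E3) (f : E3 → ℂ) (x : E3) : ℂ :=
  ∑ j, magDeriv B A j (magDeriv B A j f) x

/-- The curl of a vector field; coordinates are numbered from `0`. -/
def curl (A : E3 → E3) (x : E3) : E3 :=
  !₂[partialDeriv 1 A x 2 - partialDeriv 2 A x 1,
    partialDeriv 2 A x 0 - partialDeriv 0 A x 2,
    partialDeriv 0 A x 1 - partialDeriv 1 A x 0]

/-- The unit constant magnetic field `β = (0, 0, 1)`. -/
def unitField : E3 := !₂[0, 0, 1]

/-- The magnetic Neumann condition `ν · 𝐃ψ = 0` on `∂Ω`. -/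
def MagneticNeumannCondition (Ω : Set E3) (B : ℝ) (A : E3 → E3) (ψ : E3 → ℂ) : Prop :=
  ∀ x n, IsOuterUnitNormal Ω x n → ∑ j, (n j : ℂ) * magDeriv B A j ψ x = 0

/-- The norm of `L^p(Ω)` with respect to Lebesgue measure, with values in `[0, ∞]`. -/
def normLp {F : Type*} [NormedAddCommGroup F] (Ω : Set E3) (p : ℝ≥0∞) (f : E3 → F) : ℝ≥0∞ :=
  eLpNorm f p (volume.restrict Ω)

end MagneticNeumann

end

open MagneticNeumann

noncomputable section

namespace MagneticNeumann

open Filter Topology ComplexConjugate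

/-! ### Coordinate partial derivatives -/

section Calculus

variable {F : Type*} [NormedAddCommGroup F] [NormedSpace ℝ F]

/-! Put `u_k = D_k ψ`. The left side is the integral of `energy`, the squared covariant derivative
of `u`, and the Neumann condition says that `u` is tangential to the boundary; the estimate is
therefore a covariant div-curl (Gaffney type) inequality. Expanding squares (`energy_eq`) gives
Σ|D_j u_k|² = ½ Σ|D_j u_k − D_k u_j|² + |Σ D_j u_j|² + Re Σ i F_jk u_k ū_j + Re Q, with F =
`fieldTensor` and Q = `totalNull`. The antisymmetric part is the commutator −i F_jk ψ, the
divergence is 𝓗ψ, and |F_jk| ≤ B|curl A| ≤ B(|curl A − β| + 1). After Hölder these terms are bounded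
by the right side, so all that remains is ∫_Ω Re Q.

Q is a covariant null Lagrangian: ∫ φQ involves φ only through ∇φ (`integral_mul_nullForm`). For
weights vanishing near the boundary this leaves |∇φ||u||Du|, which is absorbed into a small multiple
of the energy at the price of C‖u‖². Near the boundary the indicator of {ρ < 0} is approximated by
smooth functions of nρ, whose gradients live in the layer −2/n ≤ ρ ≤ −1/n and play the part of
surface measure. The current along ∇ρ consists of a derivative of w = ∇ρ · u, a multiple of w, and
the Hessian of ρ evaluated on u (`fluxForm_partialDeriv`). After one more integration by parts every
non-Hessian term carries a weight n with a factor w, or n² with |w|². Tangentiality gives |w| ≤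
C|ρ|, hence w = O(1/n) in the layer, and these terms vanish in the limit. Only the curvature term
survives, and a trace inequality makes it lower order (`exists_abs_integral_layerSlope_le`); the
diamagnetic inequality keeps its constant independent of A and B.

Compactness of the boundary glues finitely many charts (`isControlled_one`). Cutoffs at infinity
keep the energy finite while part of it is absorbed, and Fatou's lemma removes them
(`lintegral_energy_le`). Since A is only C¹, so is `u`: the integral identities must be obtained
without second derivatives of `u`. -/

lemma contDiff_partialDeriv {n m : WithTop ℕ∞} {f : E3 → F} (hf : ContDiff ℝ n f)
    (hmn : m + 1 ≤ n) (j : Fin 3) : ContDiff ℝ m (partialDeriv j f) :=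
  (hf.fderiv_right hmn).clm_apply contDiff_const

lemma continuous_partialDeriv {f : E3 → F} (hf : ContDiff ℝ 1 f) (j : Fin 3) :
    Continuous (partialDeriv j f) :=
  (contDiff_partialDeriv (m := 0) hf (by simp) j).continuous

lemma hasCompactSupport_partialDeriv {f : E3 → F} (hf : HasCompactSupport f) (j : Fin 3) :
    HasCompactSupport (partialDeriv j f) :=
  hf.fderiv_apply ℝ _

lemma norm_partialDeriv_le (f : E3 → F) (j : Fin 3) (x : E3) :
    ‖partialDeriv j f x‖ ≤ ‖fderiv ℝ f x‖ := by
  simpa [partialDeriv] using (fderiv ℝ f x).le_opNorm (EuclideanSpace.single j 1)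

lemma partialDeriv_add {f g : E3 → F} {x : E3} (hf : DifferentiableAt ℝ f x)
    (hg : DifferentiableAt ℝ g x) (j : Fin 3) :
    partialDeriv j (fun y => f y + g y) x = partialDeriv j f x + partialDeriv j g x := by
  simp [partialDeriv, fderiv_fun_add hf hg]

lemma partialDeriv_sum {ι : Type*} {s : Finset ι} {f : ι → E3 → F} {x : E3}
    (hf : ∀ i ∈ s, DifferentiableAt ℝ (f i) x) (j : Fin 3) :
    partialDeriv j (fun y => ∑ i ∈ s, f i y) x = ∑ i ∈ s, partialDeriv j (f i) x := by
  simp [partialDeriv, fderiv_fun_sum hf]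

lemma partialDeriv_mul {𝔸 : Type*} [NormedCommRing 𝔸] [NormedAlgebra ℝ 𝔸] {f g : E3 → 𝔸} {x : E3}
    (hf : DifferentiableAt ℝ f x) (hg : DifferentiableAt ℝ g x) (j : Fin 3) :
    partialDeriv j (fun y => f y * g y) x = partialDeriv j f x * g x + f x * partialDeriv j g x := by
  simp [partialDeriv, fderiv_fun_mul hf hg]
  ring

lemma partialDeriv_const_mul {f : E3 → ℂ} {x : E3} (c : ℂ)
    (hf : DifferentiableAt ℝ f x) (j : Fin 3) :
    partialDeriv j (fun y => c * f y) x = c * partialDeriv j f x := by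
  simp [partialDeriv, fderiv_const_mul hf]

lemma partialDeriv_ofReal {f : E3 → ℝ} {x : E3} (hf : DifferentiableAt ℝ f x) (j : Fin 3) :
    partialDeriv j (fun y => (f y : ℂ)) x = ((partialDeriv j f x : ℝ) : ℂ) := by
  have := (Complex.ofRealCLM.hasFDerivAt.comp x hf.hasFDerivAt).fderiv
  simp only [partialDeriv]
  change fderiv ℝ (Complex.ofRealCLM ∘ f) x _ = _
  rw [this]; simp

lemma partialDeriv_conj {f : E3 → ℂ} {x : E3} (hf : DifferentiableAt ℝ f x) (j : Fin 3) :
    partialDeriv j (fun y => conj (f y)) x = conj (partialDeriv j f x) := by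
  have := ((Complex.conjCLE : ℂ →L[ℝ] ℂ).hasFDerivAt.comp x hf.hasFDerivAt).fderiv
  simp only [partialDeriv]
  change fderiv ℝ ((Complex.conjCLE : ℂ →L[ℝ] ℂ) ∘ f) x _ = _
  rw [this]; simp

lemma partialDeriv_apply {f : E3 → E3} {x : E3} (hf : DifferentiableAt ℝ f x) (j k : Fin 3) :
    partialDeriv j (fun y => f y k) x = partialDeriv j f x k := by
  have := ((EuclideanSpace.proj (𝕜 := ℝ) k : E3 →L[ℝ] ℝ).hasFDerivAt.comp x hf.hasFDerivAt).fderiv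
  simp only [partialDeriv]
  change fderiv ℝ ((EuclideanSpace.proj (𝕜 := ℝ) k : E3 →L[ℝ] ℝ) ∘ f) x _ = _
  rw [this]; simp

lemma partialDeriv_congr {f g : E3 → F} {x : E3} (h : f =ᶠ[𝓝 x] g) (j : Fin 3) :
    partialDeriv j f x = partialDeriv j g x := by
  simp [partialDeriv, h.fderiv_eq]

lemma partialDeriv_comp {f : ℝ → ℝ} {g : E3 → ℝ} {x : E3} (hf : DifferentiableAt ℝ f (g x))
    (hg : DifferentiableAt ℝ g x) (j : Fin 3) :
    partialDeriv j (fun y => f (g y)) x = deriv f (g x) * partialDeriv j g x := by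
  have := (hf.hasDerivAt.comp_hasFDerivAt x hg.hasFDerivAt).fderiv
  simp only [partialDeriv]
  change fderiv ℝ (f ∘ g) x _ = _
  rw [this]; simp

lemma partialDeriv_comm {f : E3 → F} (hf : ContDiff ℝ 2 f) (j k : Fin 3) (x : E3) :
    partialDeriv j (partialDeriv k f) x = partialDeriv k (partialDeriv j f) x := by
  have h : ∀ v w : E3, fderiv ℝ (fun y => fderiv ℝ f y v) x w = fderiv ℝ (fderiv ℝ f) x w v := by
    intro v w
    have hd : DifferentiableAt ℝ (fderiv ℝ f) x :=
      ((hf.fderiv_right (m := 1) (by norm_num)).differentiable (by norm_num)) x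
    rw [fderiv_clm_apply hd (differentiableAt_const v)]
    simp
  have hs : IsSymmSndFDerivAt ℝ f x :=
    hf.contDiffAt.isSymmSndFDerivAt (by simp)
  change fderiv ℝ (fun y => fderiv ℝ f y _) x _ = fderiv ℝ (fun y => fderiv ℝ f y _) x _
  rw [h, h]
  exact hs _ _

end Calculus

/-! ### Integration by parts and weak symmetry of second derivatives -/

section IntegrationByParts

lemma integral_partialDeriv_eq_zero {𝕜 : Type*} [RCLike 𝕜] {f : E3 → 𝕜} (hf : ContDiff ℝ 1 f)
    (hc : HasCompactSupport f)
    (j : Fin 3) : ∫ x, partialDeriv j f x = 0 := by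
  have hi := (continuous_partialDeriv hf j).integrable_of_hasCompactSupport (μ := volume)
    (hasCompactSupport_partialDeriv hc j)
  have := integral_mul_fderiv_eq_neg_fderiv_mul_of_integrable (μ := (volume : Measure E3))
    (f := fun _ : E3 => (1 : 𝕜)) (g := f) (v := EuclideanSpace.single j 1) (by simp)
    (by simp only [one_mul]; exact hi)
    (by simpa using hf.continuous.integrable_of_hasCompactSupport hc) (by simp)
    (fun x _ => hf.differentiable (by norm_num) x)
  simpa [partialDeriv] using this

lemma integral_mul_partialDeriv {f g : E3 → ℂ} (hf : ContDiff ℝ 1 f) (hg : ContDiff ℝ 1 g)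
    (hc : HasCompactSupport f) (j : Fin 3) :
    ∫ x, f x * partialDeriv j g x = - ∫ x, partialDeriv j f x * g x := by
  have h := integral_partialDeriv_eq_zero (hf.mul hg) hc.mul_right j
  have e : ∀ x, partialDeriv j (fun y => f y * g y) x
      = partialDeriv j f x * g x + f x * partialDeriv j g x := fun x =>
    partialDeriv_mul (hf.differentiable (by norm_num) x) (hg.differentiable (by norm_num) x) j
  simp_rw [e] at h
  rw [integral_add] at h
  · exact eq_neg_of_add_eq_zero_right h
  · exact ((continuous_partialDeriv hf j).mul hg.continuous).integrable_of_hasCompactSupport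
      (hasCompactSupport_partialDeriv hc j).mul_right
  · exact (hf.continuous.mul (continuous_partialDeriv hg j)).integrable_of_hasCompactSupport
      hc.mul_right

lemma tendsto_differenceQuotient {f : E3 → ℂ} {x : E3} (hf : DifferentiableAt ℝ f x) (v : E3)
    {t : ℕ → ℝ} (ht : Tendsto t atTop (𝓝[≠] 0)) :
    Tendsto (fun n => (t n : ℂ)⁻¹ * (f (x + t n • v) - f x)) atTop (𝓝 (fderiv ℝ f x v)) := by
  have h := (hf.hasFDerivAt.hasLineDerivAt v)
  rw [hasLineDerivAt_iff_tendsto_slope_zero] at h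
  refine (h.comp ht).congr fun n => ?_
  simp [Complex.real_smul]

/-- Summation by parts: translation invariance moves the difference onto `g`, with the opposite
shift. -/
lemma integral_differenceQuotient_mul {f g : E3 → ℂ} (hf : Continuous f) (hg : Continuous g)
    (hc : HasCompactSupport f) (v : E3) (t : ℂ) :
    ∫ x, t * (f (x + v) - f x) * g x = ∫ x, f x * (t * (g (x - v) - g x)) := by
  have i1 : Integrable (fun x => t * f x * g (x - v)) :=
    ((continuous_const.mul hf).mul
      (hg.comp (continuous_id.sub continuous_const))).integrable_of_hasCompactSupport
      (hc.mul_left.mul_right)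
  have i2 : Integrable (fun x => t * f x * g x) :=
    ((continuous_const.mul hf).mul hg).integrable_of_hasCompactSupport (hc.mul_left.mul_right)
  have i3 : Integrable (fun x => t * f (x + v) * g x) := by
    simpa using i1.comp_add_right v
  have e1 : ∫ x, t * f (x + v) * g x = ∫ x, t * f x * g (x - v) := by
    have := integral_add_right_eq_self (μ := (volume : Measure E3))
      (fun x => t * f x * g (x - v)) v
    simpa using this
  calc ∫ x, t * (f (x + v) - f x) * g x
      = ∫ x, (t * f (x + v) * g x - t * f x * g x) := by congr 1; ext x; ring
    _ = ∫ x, (t * f x * g (x - v) - t * f x * g x) := by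
        rw [integral_sub i3 i2, integral_sub i1 i2, e1]
    _ = _ := by congr 1; ext x; ring

/-- For C² functions two integrations by parts suffice. For C¹ functions the `j`-derivative is
replaced by a difference quotient, which commutes with `∂_k`, so that the identity is exact for each
step size; Lipschitz bounds then allow dominated convergence. -/
lemma integral_partialDeriv_mul_comm_of_hasCompactSupport {h g : E3 → ℂ} (hh : ContDiff ℝ 1 h)
    (hg : ContDiff ℝ 1 g) (hc : HasCompactSupport h) (gc : HasCompactSupport g) (j k : Fin 3) :
    ∫ x, partialDeriv j h x * partialDeriv k g x = ∫ x, partialDeriv k h x * partialDeriv j g x := by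
  obtain ⟨Ch, hCh⟩ := hh.lipschitzWith_of_hasCompactSupport hc (by norm_num)
  obtain ⟨Cg, hCg⟩ := hg.lipschitzWith_of_hasCompactSupport gc (by norm_num)
  set v : E3 := EuclideanSpace.single j 1 with hv
  have hvn : ‖v‖ = 1 := by simp [hv]
  set t : ℕ → ℝ := fun n => 1 / ((n : ℝ) + 1)
  have ht0 : ∀ n, t n ≠ 0 := fun n => by positivity
  have ht : Tendsto t atTop (𝓝[≠] 0) :=
    tendsto_nhdsWithin_iff.2 ⟨tendsto_one_div_add_atTop_nhds_zero_nat, Eventually.of_forall ht0⟩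
  have bound : ∀ {C : NNReal} {f : E3 → ℂ}, LipschitzWith C f → ∀ (s : ℝ), s ≠ 0 → ∀ x,
      ‖(s : ℂ)⁻¹ * (f (x + s • v) - f x)‖ ≤ C := by
    intro C f hf s hs x
    have := hf.dist_le_mul (x + s • v) x
    rw [dist_eq_norm, dist_eq_norm] at this
    simp only [add_sub_cancel_left, norm_smul, hvn, mul_one] at this
    rw [norm_mul, norm_inv, Complex.norm_real, inv_mul_le_iff₀ (by positivity), mul_comm]
    exact this
  have hk := continuous_partialDeriv hh k
  have gk := continuous_partialDeriv hg k
  have L1 : Tendsto (fun n => ∫ x, (t n : ℂ)⁻¹ * (h (x + t n • v) - h x) * partialDeriv k g x) atTop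
      (𝓝 (∫ x, partialDeriv j h x * partialDeriv k g x)) := by
    refine tendsto_integral_of_dominated_convergence (fun x => Ch * ‖partialDeriv k g x‖) ?_ ?_ ?_ ?_
    · intro n
      exact (by fun_prop (disch := assumption) : Continuous _).aestronglyMeasurable
    · exact (gk.integrable_of_hasCompactSupport
        (hasCompactSupport_partialDeriv gc k)).norm.const_mul _
    · intro n
      refine Eventually.of_forall fun x => ?_
      rw [norm_mul]
      gcongr
      exact bound hCh _ (ht0 n) x
    · exact Eventually.of_forall fun x =>
        (tendsto_differenceQuotient (hh.differentiable (by norm_num) x) v ht).mul_const _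
  -- The backward quotient of `g` tends to `−∂_j g`, which accounts for the minus sign.
  have L2 : Tendsto (fun n => ∫ x, -(partialDeriv k h x * ((t n : ℂ)⁻¹ * (g (x - t n • v) - g x))))
      atTop (𝓝 (∫ x, partialDeriv k h x * partialDeriv j g x)) := by
    refine tendsto_integral_of_dominated_convergence (fun x => ‖partialDeriv k h x‖ * Cg) ?_ ?_ ?_ ?_
    · intro n
      exact (by fun_prop (disch := assumption) : Continuous _).aestronglyMeasurable
    · exact (hk.integrable_of_hasCompactSupport
        (hasCompactSupport_partialDeriv hc k)).norm.mul_const _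
    · intro n
      refine Eventually.of_forall fun x => ?_
      rw [norm_neg, norm_mul]
      gcongr
      simpa [sub_eq_add_neg] using bound hCg (-t n) (neg_ne_zero.2 (ht0 n)) x
    · refine Eventually.of_forall fun x => ?_
      have ht' : Tendsto (fun n => -t n) atTop (𝓝[≠] 0) := by
        refine tendsto_nhdsWithin_iff.2 ⟨?_, Eventually.of_forall fun n => neg_ne_zero.2 (ht0 n)⟩
        simpa using (tendsto_nhdsWithin_iff.1 ht).1.neg
      have := (tendsto_differenceQuotient (hg.differentiable (by norm_num) x) v ht').const_mul
        (partialDeriv k h x)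
      refine this.congr fun n => ?_
      simp [sub_eq_add_neg, inv_neg]
  refine tendsto_nhds_unique L1 (L2.congr fun n => ?_)
  rw [integral_neg, ← integral_differenceQuotient_mul hk hg.continuous
    (hasCompactSupport_partialDeriv hc k)]
  have hsh : ContDiff ℝ 1 (fun x => h (x + t n • v)) := hh.comp (contDiff_id.add contDiff_const)
  have csh : HasCompactSupport (fun x => h (x + t n • v)) :=
    hc.comp_homeomorph (Homeomorph.addRight (t n • v))
  have hF : ContDiff ℝ 1 (fun x => (t n : ℂ)⁻¹ * (h (x + t n • v) - h x)) :=
    contDiff_const.mul (hsh.sub hh)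
  have cF : HasCompactSupport (fun x => (t n : ℂ)⁻¹ * (h (x + t n • v) - h x)) :=
    (csh.sub hc).mul_left
  rw [integral_mul_partialDeriv hF hg cF k]
  congr 2
  ext x
  congr 1
  have d1 : DifferentiableAt ℝ (fun x => h (x + t n • v)) x := hsh.differentiable (by norm_num) x
  have d2 : DifferentiableAt ℝ h x := hh.differentiable (by norm_num) x
  rw [partialDeriv_const_mul (f := fun x => h (x + t n • v) - h x) _ (d1.sub d2)]
  simp only [partialDeriv]
  rw [fderiv_fun_sub d1 d2, fderiv_comp_add_right]
  simp

lemma exists_cutoff (R : ℝ) (hR : 0 < R) : ∃ θ : E3 → ℝ, ContDiff ℝ ∞ θ ∧ HasCompactSupport θ ∧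
    (∀ x ∈ Metric.closedBall (0 : E3) R, θ x = 1) ∧ (∀ x, |θ x| ≤ 1) := by
  let b : ContDiffBump (0 : E3) := ⟨R, R + 1, hR, by linarith⟩
  exact ⟨b, b.contDiff, b.hasCompactSupport, fun x hx => b.one_of_mem_closedBall hx,
    fun x => abs_le.2 ⟨by linarith [b.nonneg (x := x)], b.le_one⟩⟩

/-- Only the values of `g` near the support of `h` matter, so `g` may be multiplied by a cutoff
equal to 1 there. -/
lemma integral_partialDeriv_mul_comm {h g : E3 → ℂ} (hh : ContDiff ℝ 1 h) (hg : ContDiff ℝ 1 g)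
    (hc : HasCompactSupport h) (j k : Fin 3) :
    ∫ x, partialDeriv j h x * partialDeriv k g x = ∫ x, partialDeriv k h x * partialDeriv j g x := by
  obtain ⟨R, hR, hs⟩ := (show IsCompact (tsupport h) from hc).isBounded.subset_ball_lt 0 (0 : E3)
  obtain ⟨θ, hθ, θc, θ1, -⟩ := exists_cutoff R hR
  have hθ' : ContDiff ℝ 1 (fun x => (θ x : ℂ)) :=
    Complex.ofRealCLM.contDiff.comp (hθ.of_le (by exact_mod_cast le_top))
  have e : ∀ i l x, partialDeriv i h x * partialDeriv l (fun y => (θ y : ℂ) * g y) x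
      = partialDeriv i h x * partialDeriv l g x := by
    intro i l x
    by_cases hx : x ∈ tsupport h
    · congr 1
      apply partialDeriv_congr
      filter_upwards [Metric.isOpen_ball.mem_nhds (hs hx)] with y hy
      simp [θ1 y (Metric.ball_subset_closedBall hy)]
    · have : partialDeriv i h x = 0 := by
        simp only [partialDeriv]
        rw [image_eq_zero_of_notMem_tsupport (fun h' => hx (tsupport_fderiv_subset ℝ h'))]
        simp
      simp [this]
  have := integral_partialDeriv_mul_comm_of_hasCompactSupport hh (hθ'.mul hg) hc
    ((θc.comp_left (g := ((↑) : ℝ → ℂ)) (by simp)).mul_right) j k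
  simpa only [e] using this

end IntegrationByParts

/-! ### Magnetic derivatives, their commutators and the null forms -/

section MagneticDerivative

variable {B : ℝ} {A : E3 → E3}

lemma contDiff_ofReal {n : WithTop ℕ∞} {φ : E3 → ℝ} (h : ContDiff ℝ n φ) :
    ContDiff ℝ n (fun x => (φ x : ℂ)) :=
  Complex.ofRealCLM.contDiff.comp h

lemma contDiff_conj {n : WithTop ℕ∞} {f : E3 → ℂ} (h : ContDiff ℝ n f) :
    ContDiff ℝ n (fun x => conj (f x)) :=
  (Complex.conjCLE : ℂ →L[ℝ] ℂ).contDiff.comp h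

lemma contDiff_apply_component {n : WithTop ℕ∞} (hA : ContDiff ℝ n A) (j : Fin 3) :
    ContDiff ℝ n (fun x => A x j) :=
  (EuclideanSpace.proj (𝕜 := ℝ) j : E3 →L[ℝ] ℝ).contDiff.comp hA

lemma hasCompactSupport_ofReal {φ : E3 → ℝ} (h : HasCompactSupport φ) :
    HasCompactSupport (fun x => (φ x : ℂ)) :=
  h.comp_left (g := ((↑) : ℝ → ℂ)) (by simp)

lemma continuous_magDeriv {f : E3 → ℂ} (hA : Continuous A) (hf : ContDiff ℝ 1 f) (j : Fin 3) :
    Continuous (magDeriv B A j f) := by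
  have h1 := continuous_partialDeriv hf j
  have h2 := hf.continuous
  unfold magDeriv
  fun_prop

lemma contDiff_magDeriv {f : E3 → ℂ} (hA : ContDiff ℝ 1 A) (hf : ContDiff ℝ 2 f) (j : Fin 3) :
    ContDiff ℝ 1 (magDeriv B A j f) := by
  have h1 := contDiff_partialDeriv (m := 1) hf (by norm_num) j
  have h2 : ContDiff ℝ 1 f := hf.of_le (by norm_num)
  exact (contDiff_const.mul h1).add ((contDiff_const.mul
    (contDiff_ofReal (contDiff_apply_component hA j))).mul h2)

lemma magDeriv_mul {φ f : E3 → ℂ} {x : E3} (hφ : DifferentiableAt ℝ φ x)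
    (hf : DifferentiableAt ℝ f x) (j : Fin 3) :
    magDeriv B A j (fun y => φ y * f y) x
      = φ x * magDeriv B A j f x - Complex.I * partialDeriv j φ x * f x := by
  simp only [magDeriv, partialDeriv_mul hφ hf]
  ring

lemma magDeriv_sum {ι : Type*} {s : Finset ι} {f : ι → E3 → ℂ} {x : E3}
    (hf : ∀ i ∈ s, DifferentiableAt ℝ (f i) x) (j : Fin 3) :
    magDeriv B A j (fun y => ∑ i ∈ s, f i y) x = ∑ i ∈ s, magDeriv B A j (f i) x := by
  simp only [magDeriv, partialDeriv_sum hf, Finset.mul_sum, Finset.sum_add_distrib]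

/-- The operators `D_j` are symmetric on functions with compact support. -/
lemma integral_mul_conj_magDeriv {f g : E3 → ℂ} (hA : Continuous A) (hf : ContDiff ℝ 1 f)
    (hg : ContDiff ℝ 1 g) (hc : HasCompactSupport f) (j : Fin 3) :
    ∫ x, f x * conj (magDeriv B A j g x) = ∫ x, magDeriv B A j f x * conj (g x) := by
  have key := integral_mul_partialDeriv hf (contDiff_conj hg) hc j
  have hf0 := hf.continuous
  have hg0 := hg.continuous
  have hf1 := continuous_partialDeriv hf j
  have hg1 := continuous_partialDeriv hg j
  have hgc : ∀ x, partialDeriv j (fun y => conj (g y)) x = conj (partialDeriv j g x) := fun x =>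
    partialDeriv_conj (hg.differentiable (by norm_num) x) j
  simp only [hgc] at key
  have i1 : Integrable (fun x => f x * conj (partialDeriv j g x)) :=
    (by fun_prop : Continuous _).integrable_of_hasCompactSupport hc.mul_right
  have i2 : Integrable (fun x => f x * ((B : ℂ) * (A x j : ℂ) * conj (g x))) :=
    (by fun_prop : Continuous _).integrable_of_hasCompactSupport hc.mul_right
  have i3 : Integrable (fun x => partialDeriv j f x * conj (g x)) :=
    (by fun_prop : Continuous _).integrable_of_hasCompactSupport
      (hasCompactSupport_partialDeriv hc j).mul_right
  calc ∫ x, f x * conj (magDeriv B A j g x)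
      = ∫ x, (Complex.I * (f x * conj (partialDeriv j g x))
          + f x * ((B : ℂ) * (A x j : ℂ) * conj (g x))) := by
        congr 1; ext x; simp [magDeriv]; ring
    _ = ∫ x, (-Complex.I * (partialDeriv j f x * conj (g x))
          + f x * ((B : ℂ) * (A x j : ℂ) * conj (g x))) := by
        rw [integral_add (i1.const_mul _) i2, integral_add (i3.const_mul _) i2,
          integral_const_mul, integral_const_mul, key]
        ring
    _ = _ := by congr 1; ext x; simp [magDeriv]; ring

/-- The component `B (∂_j A_k - ∂_k A_j)` of the magnetic field. -/
def fieldTensor (B : ℝ) (A : E3 → E3) (j k : Fin 3) (x : E3) : ℝ :=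
  B * (partialDeriv j A x k - partialDeriv k A x j)

lemma continuous_fieldTensor (hA : ContDiff ℝ 1 A) (j k : Fin 3) :
    Continuous (fieldTensor B A j k) := by
  have h1 := continuous_partialDeriv hA j
  have h2 := continuous_partialDeriv hA k
  unfold fieldTensor
  fun_prop

/-- Second derivatives of `f` cancel by symmetry and first-order terms cancel in pairs; only the
derivatives of `A` remain. -/
lemma magDeriv_commutator {f : E3 → ℂ} (hA : ContDiff ℝ 1 A) (hf : ContDiff ℝ 2 f)
    (j k : Fin 3) (x : E3) :
    magDeriv B A j (magDeriv B A k f) x - magDeriv B A k (magDeriv B A j f) x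
      = -Complex.I * fieldTensor B A j k x * f x := by
  have hd : DifferentiableAt ℝ f x := hf.differentiable (by norm_num) x
  have hAd : DifferentiableAt ℝ A x := hA.differentiable (by norm_num) x
  have hp : ∀ l, DifferentiableAt ℝ (partialDeriv l f) x := fun l =>
    (contDiff_partialDeriv (m := 1) hf (by norm_num) l).differentiable (by norm_num) x
  have hAl : ∀ l, DifferentiableAt ℝ (fun y => A y l) x := fun l =>
    (contDiff_apply_component hA l).differentiable (by norm_num) x
  have hAc : ∀ l, DifferentiableAt ℝ (fun y => (A y l : ℂ)) x := fun l =>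
    (contDiff_ofReal (contDiff_apply_component hA l)).differentiable (by norm_num) x
  have e : ∀ l m, partialDeriv l (magDeriv B A m f) x
      = -Complex.I * partialDeriv l (partialDeriv m f) x
        + ((B : ℂ) * (partialDeriv l A x m : ℝ) * f x
          + (B : ℂ) * (A x m : ℂ) * partialDeriv l f x) := by
    intro l m
    unfold magDeriv
    have d1 : DifferentiableAt ℝ (fun y => -Complex.I * partialDeriv m f y) x :=
      (hp m).const_mul _
    have d2 : DifferentiableAt ℝ (fun y => (B : ℂ) * (A y m : ℂ) * f y) x :=
      ((hAc m).const_mul _).mul hd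
    rw [partialDeriv_add d1 d2,
      partialDeriv_const_mul _ (hp m), partialDeriv_mul ((hAc m).const_mul _) hd,
      partialDeriv_const_mul _ (hAc m), partialDeriv_ofReal (hAl m), partialDeriv_apply hAd]
  have e' : ∀ l m, magDeriv B A l (magDeriv B A m f) x
      = -Complex.I * partialDeriv l (magDeriv B A m f) x
        + (B : ℂ) * (A x l : ℂ) * magDeriv B A m f x := fun l m => rfl
  rw [e', e', e, e, partialDeriv_comm hf j k]
  simp only [magDeriv, fieldTensor]
  push_cast
  ring

/-- The density whose integral against a test function only involves first derivatives of the
test function: `D_jf conj(D_kg) - D_kf conj(D_jg)` corrected by the magnetic field. -/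
def nullForm (B : ℝ) (A : E3 → E3) (j k : Fin 3) (f g : E3 → ℂ) (x : E3) : ℂ :=
  magDeriv B A j f x * conj (magDeriv B A k g x) - magDeriv B A k f x * conj (magDeriv B A j g x)
    - Complex.I * fieldTensor B A j k x * (f x * conj (g x))

lemma continuous_nullForm {f g : E3 → ℂ} (hA : ContDiff ℝ 1 A) (hf : ContDiff ℝ 1 f)
    (hg : ContDiff ℝ 1 g) (j k : Fin 3) : Continuous (nullForm B A j k f g) := by
  have h1 := fun l => continuous_magDeriv (B := B) hA.continuous hf l
  have h2 := fun l => continuous_magDeriv (B := B) hA.continuous hg l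
  have h3 := continuous_fieldTensor (B := B) hA j k
  have h4 := hf.continuous
  have h5 := hg.continuous
  unfold nullForm
  fun_prop

set_option maxHeartbeats 1000000 in
-- The null-Lagrangian property. Writing `h = φ f`, the difference of the two integrands is a
-- Jacobian `∂_j h ∂_k ḡ − ∂_k h ∂_j ḡ` plus exact derivatives of `A_l h ḡ`, and both integrate to
-- zero. The field term in `nullForm` is what makes the derivatives of `A` combine into exact ones.
lemma integral_mul_nullForm {φ : E3 → ℝ} {f g : E3 → ℂ} (hA : ContDiff ℝ 1 A)
    (hφ : ContDiff ℝ 1 φ) (hc : HasCompactSupport φ) (hf : ContDiff ℝ 1 f) (hg : ContDiff ℝ 1 g)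
    (j k : Fin 3) :
    ∫ x, (φ x : ℂ) * nullForm B A j k f g x
      = ∫ x, Complex.I * (partialDeriv j φ x * f x * conj (magDeriv B A k g x)
          - partialDeriv k φ x * f x * conj (magDeriv B A j g x)) := by
  have hφc := contDiff_ofReal hφ
  have hcc := hasCompactSupport_ofReal hc
  have hG := contDiff_conj hg
  have hAc := fun l => contDiff_ofReal (contDiff_apply_component hA l)
  set h : E3 → ℂ := fun x => (φ x : ℂ) * f x with hh
  have hh1 : ContDiff ℝ 1 h := hφc.mul hf
  have hhc : HasCompactSupport h := hcc.mul_right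
  set P : Fin 3 → E3 → ℂ := fun l x => (A x l : ℂ) * (h x * conj (g x)) with hP
  have hP1 : ∀ l, ContDiff ℝ 1 (P l) := fun l => (hAc l).mul (hh1.mul hG)
  have hPc : ∀ l, HasCompactSupport (P l) := fun l => hhc.mul_right.mul_left
  have cφ := fun l => continuous_partialDeriv hφ l
  have cf := hf.continuous
  have cg := hg.continuous
  have cA := hA.continuous
  have cP := fun l m => continuous_partialDeriv (hP1 l) m
  have ch := fun l => continuous_partialDeriv hh1 l
  have cG := fun l => continuous_partialDeriv hG l
  have cD := fun l => continuous_magDeriv (B := B) cA hg l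
  have iP : ∀ l m, Integrable (partialDeriv m (P l)) := fun l m =>
    (cP l m).integrable_of_hasCompactSupport (hasCompactSupport_partialDeriv (hPc l) m)
  have iN : ∀ l m, Integrable (fun x => partialDeriv l h x
      * partialDeriv m (fun y => conj (g y)) x) := fun l m =>
    ((ch l).mul (cG m)).integrable_of_hasCompactSupport
      (hasCompactSupport_partialDeriv hhc l).mul_right
  have iR : ∀ l m, Integrable (fun x => ((partialDeriv l φ x : ℝ) : ℂ) * f x
      * conj (magDeriv B A m g x)) := fun l m =>
    (by fun_prop : Continuous _).integrable_of_hasCompactSupport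
      (hasCompactSupport_ofReal (hasCompactSupport_partialDeriv hc l)).mul_right.mul_right
  have pt : ∀ x, (φ x : ℂ) * nullForm B A j k f g x
      = Complex.I * (partialDeriv j φ x * f x * conj (magDeriv B A k g x)
          - partialDeriv k φ x * f x * conj (magDeriv B A j g x))
        + ((partialDeriv j h x * partialDeriv k (fun y => conj (g y)) x
            - partialDeriv k h x * partialDeriv j (fun y => conj (g y)) x)
          + (-Complex.I * B * partialDeriv j (P k) x + Complex.I * B * partialDeriv k (P j) x)) := by
    intro x
    have dφ := hφ.differentiable (by norm_num) x
    have dφc := hφc.differentiable (by norm_num) x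
    have df := hf.differentiable (by norm_num) x
    have dg := hg.differentiable (by norm_num) x
    have dG := hG.differentiable (by norm_num) x
    have dh := hh1.differentiable (by norm_num) x
    have dA := hA.differentiable (by norm_num) x
    have dAl := fun l => (contDiff_apply_component hA l).differentiable (by norm_num) x
    have eh : ∀ l, partialDeriv l h x
        = (partialDeriv l φ x : ℝ) * f x + φ x * partialDeriv l f x := fun l => by
      rw [hh, partialDeriv_mul dφc df, partialDeriv_ofReal dφ]
    have eG : ∀ l, partialDeriv l (fun y => conj (g y)) x = conj (partialDeriv l g x) := fun l =>
      partialDeriv_conj dg l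
    have eP : ∀ l m, partialDeriv m (P l) x = (partialDeriv m A x l : ℝ) * (h x * conj (g x))
        + (A x l : ℂ) * (partialDeriv m h x * conj (g x) + h x * conj (partialDeriv m g x)) := by
      intro l m
      have d1 : DifferentiableAt ℝ (fun y => h y * conj (g y)) x := dh.mul dG
      rw [hP]
      simp only
      rw [partialDeriv_mul ((hAc l).differentiable (by norm_num) x) d1,
        partialDeriv_mul dh dG, partialDeriv_ofReal (dAl l), partialDeriv_apply dA, eG]
    simp only [eP, eh, eG, nullForm, magDeriv, fieldTensor]
    simp only [hh]
    simp only [map_add, map_mul, map_neg, Complex.conj_I, Complex.conj_ofReal]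
    push_cast
    linear_combination (-(partialDeriv j f x * conj (partialDeriv k g x)
      - partialDeriv k f x * conj (partialDeriv j g x)) * (φ x : ℂ)
      - f x * ((partialDeriv j φ x : ℝ) * conj (partialDeriv k g x)
      - (partialDeriv k φ x : ℝ) * conj (partialDeriv j g x))) * Complex.I_sq
  simp_rw [pt]
  rw [integral_add, integral_add, integral_sub (iN j k) (iN k j), integral_add,
    integral_const_mul (-Complex.I * B), integral_const_mul (Complex.I * B),
    integral_partialDeriv_eq_zero (hP1 k) (hPc k), integral_partialDeriv_eq_zero (hP1 j) (hPc j),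
    integral_partialDeriv_mul_comm hh1 hG hhc]
  · simp
  · exact (iP k j).const_mul _
  · exact (iP j k).const_mul _
  · exact (iN j k).sub (iN k j)
  · exact ((iP k j).const_mul _).add ((iP j k).const_mul _)
  · exact ((iR j k).sub (iR k j)).const_mul _
  · exact ((iN j k).sub (iN k j)).add (((iP k j).const_mul _).add ((iP j k).const_mul _))

end MagneticDerivative

/-! ### Weighted integrals of the null forms; weights vanishing near the boundary -/

section Weighted

variable {B : ℝ} {A : E3 → E3} {u : Fin 3 → E3 → ℂ} {Ω : Set E3}

/-- The pointwise squared length of a complex vector field. -/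
def sqNorm (u : Fin 3 → E3 → ℂ) (x : E3) : ℝ := ∑ k, ‖u k x‖ ^ 2

/-- The pointwise squared length of the covariant derivative of a complex vector field. -/
def energy (B : ℝ) (A : E3 → E3) (u : Fin 3 → E3 → ℂ) (x : E3) : ℝ :=
  ∑ j, ∑ k, ‖magDeriv B A j (u k) x‖ ^ 2

/-- The sum of the null forms of a complex vector field. -/
def totalNull (B : ℝ) (A : E3 → E3) (u : Fin 3 → E3 → ℂ) (x : E3) : ℂ :=
  ∑ j, ∑ k, nullForm B A j k (u k) (u j) x

/-- The pairing of a covector with the current of a complex vector field. -/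
def fluxForm (B : ℝ) (A : E3 → E3) (u : Fin 3 → E3 → ℂ) (p : Fin 3 → ℝ) (x : E3) : ℂ :=
  ∑ j, ∑ k, (p j * u k x * conj (magDeriv B A k (u j) x)
    - p k * u k x * conj (magDeriv B A j (u j) x))

lemma sqNorm_nonneg (x : E3) : 0 ≤ sqNorm u x := by unfold sqNorm; positivity

lemma energy_nonneg (x : E3) : 0 ≤ energy B A u x := by unfold energy; positivity

lemma norm_le_sqrt_sqNorm (k : Fin 3) (x : E3) : ‖u k x‖ ≤ √(sqNorm u x) :=
  Real.le_sqrt_of_sq_le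
    (Finset.single_le_sum (f := fun k => ‖u k x‖ ^ 2) (fun _ _ => by positivity) (Finset.mem_univ k))

lemma norm_magDeriv_le_sqrt_energy (j k : Fin 3) (x : E3) :
    ‖magDeriv B A j (u k) x‖ ≤ √(energy B A u x) := by
  refine Real.le_sqrt_of_sq_le (le_trans ?_ (Finset.single_le_sum
    (f := fun j => ∑ k, ‖magDeriv B A j (u k) x‖ ^ 2) (fun _ _ => by positivity)
    (Finset.mem_univ j)))
  exact Finset.single_le_sum (f := fun k => ‖magDeriv B A j (u k) x‖ ^ 2)
    (fun _ _ => by positivity) (Finset.mem_univ k)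

lemma continuous_sqNorm (hu : ∀ k, ContDiff ℝ 1 (u k)) : Continuous (sqNorm u) := by
  have := fun k => (hu k).continuous
  unfold sqNorm
  fun_prop

lemma continuous_energy (hA : ContDiff ℝ 1 A) (hu : ∀ k, ContDiff ℝ 1 (u k)) :
    Continuous (energy B A u) := by
  have := fun j k => continuous_magDeriv (B := B) hA.continuous (hu k) j
  unfold energy
  fun_prop

lemma continuous_totalNull (hA : ContDiff ℝ 1 A) (hu : ∀ k, ContDiff ℝ 1 (u k)) :
    Continuous (totalNull B A u) := by
  have := fun j k => continuous_nullForm (B := B) hA (hu k) (hu j) j k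
  unfold totalNull
  fun_prop

lemma integral_mul_totalNull {φ : E3 → ℝ} (hA : ContDiff ℝ 1 A) (hu : ∀ k, ContDiff ℝ 1 (u k))
    (hφ : ContDiff ℝ 1 φ) (hc : HasCompactSupport φ) :
    ∫ x, (φ x : ℂ) * totalNull B A u x
      = Complex.I * ∫ x, fluxForm B A u (fun j => partialDeriv j φ x) x := by
  have cN := fun j k => continuous_nullForm (B := B) hA (hu k) (hu j) j k
  have cD := fun j k => continuous_magDeriv (B := B) hA.continuous (hu k) j
  have cφ := hφ.continuous
  have cdφ := fun l => continuous_partialDeriv hφ l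
  have cu := fun k => (hu k).continuous
  have i1 : ∀ j k, Integrable (fun x => (φ x : ℂ) * nullForm B A j k (u k) (u j) x) := fun j k =>
    (by fun_prop : Continuous _).integrable_of_hasCompactSupport
      (hasCompactSupport_ofReal hc).mul_right
  have i2 : ∀ j l k m, Integrable (fun x => ((partialDeriv j φ x : ℝ) : ℂ) * u l x
      * conj (magDeriv B A k (u m) x)) := fun j l k m =>
    (by fun_prop : Continuous _).integrable_of_hasCompactSupport
      (hasCompactSupport_ofReal (hasCompactSupport_partialDeriv hc j)).mul_right.mul_right
  have i3 : ∀ j k, Integrable (fun x => ((partialDeriv j φ x : ℝ) * u k x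
      * conj (magDeriv B A k (u j) x) - (partialDeriv k φ x : ℝ) * u k x
      * conj (magDeriv B A j (u j) x))) := fun j k => by
    exact (i2 j k k j).sub (i2 k k j j)
  simp only [totalNull, fluxForm, Finset.mul_sum]
  rw [integral_finsetSum _ fun j _ => integrable_finsetSum _ fun k _ => i1 j k,
    integral_finsetSum _ fun j _ => integrable_finsetSum _ fun k _ => i3 j k, Finset.mul_sum]
  refine Finset.sum_congr rfl fun j _ => ?_
  rw [integral_finsetSum _ fun k _ => i1 j k, integral_finsetSum _ fun k _ => i3 j k,
    Finset.mul_sum]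
  refine Finset.sum_congr rfl fun k _ => ?_
  rw [integral_mul_nullForm hA hφ hc (hu k) (hu j), integral_const_mul]

/-- The constant 18 counts nine index pairs with two products each. -/
lemma norm_fluxForm_le {p : Fin 3 → ℝ} {a : ℝ} (hp : ∀ j, |p j| ≤ a) (x : E3) :
    ‖fluxForm B A u p x‖ ≤ 18 * a * (√(sqNorm u x) * √(energy B A u x)) := by
  have ha : 0 ≤ a := (abs_nonneg _).trans (hp 0)
  have h : ∀ j k l m, ‖(p j : ℂ) * u k x * conj (magDeriv B A l (u m) x)‖
      ≤ a * (√(sqNorm u x) * √(energy B A u x)) := by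
    intro j k l m
    rw [norm_mul, norm_mul, RCLike.norm_conj, Complex.norm_real, mul_assoc]
    have := hp j
    have := norm_le_sqrt_sqNorm (u := u) k x
    have := norm_magDeriv_le_sqrt_energy (B := B) (A := A) (u := u) l m x
    rw [Real.norm_eq_abs]
    gcongr
  calc _ ≤ ∑ j : Fin 3, ∑ k : Fin 3, 2 * (a * (√(sqNorm u x) * √(energy B A u x))) := by
        refine norm_sum_le_of_le _ fun j _ => norm_sum_le_of_le _ fun k _ => ?_
        refine (norm_sub_le _ _).trans ?_
        linarith [h j k k j, h k k j j]
    _ = _ := by simp; ring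

/-- The vector field `u` satisfies `ν · u = 0` on the boundary of `Ω`. -/
def IsTangential (Ω : Set E3) (u : Fin 3 → E3 → ℂ) : Prop :=
  ∀ x n, IsOuterUnitNormal Ω x n → ∑ j, (n j : ℂ) * u j x = 0

/-- The vector fields `A`, `u` and the cutoff function `X` to which the weighted estimates apply. -/
structure IsAdmissible (Ω : Set E3) (A : E3 → E3) (u : Fin 3 → E3 → ℂ) (X : E3 → ℝ) : Prop where
  contDiff_potential : ContDiff ℝ 1 A
  contDiff_field : ∀ k, ContDiff ℝ 1 (u k)
  tangential : IsTangential Ω u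
  contDiff_cutoff : ContDiff ℝ ∞ X
  hasCompactSupport_cutoff : HasCompactSupport X
  abs_cutoff_le : ∀ x, |X x| ≤ 1
  abs_partialDeriv_cutoff_le : ∀ j x, |partialDeriv j X x| ≤ 1
  integrableOn_sqNorm : IntegrableOn (sqNorm u) Ω

/-- The integral over `Ω` of the null forms with weight `ζ` is of lower order. -/
def IsControlled (Ω : Set E3) (ζ : E3 → ℝ) : Prop :=
  ∀ δ > 0, ∃ C : ℝ, ∀ (B : ℝ) (A : E3 → E3) (u : Fin 3 → E3 → ℂ) (X : E3 → ℝ),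
    IsAdmissible Ω A u X →
    ‖∫ x in Ω, ((X x ^ 2 * ζ x : ℝ) : ℂ) * totalNull B A u x‖
      ≤ δ * (∫ x in Ω, X x ^ 2 * energy B A u x) + C * ∫ x in Ω, sqNorm u x

namespace IsAdmissible

variable {X : E3 → ℝ} (h : IsAdmissible Ω A u X)
include h

lemma hasCompactSupport_sq_mul (ζ : E3 → ℝ) : HasCompactSupport (fun x => X x ^ 2 * ζ x) := by
  simp only [pow_two, mul_assoc]
  exact h.hasCompactSupport_cutoff.mul_right

lemma contDiff_sq_mul {n : WithTop ℕ∞} (hn : n ≤ (∞ : WithTop ℕ∞)) {ζ : E3 → ℝ}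
    (hζ : ContDiff ℝ n ζ) :
    ContDiff ℝ n (fun x => X x ^ 2 * ζ x) :=
  ((h.contDiff_cutoff.of_le hn).pow 2).mul hζ

lemma integrable_sq_mul_energy : Integrable (fun x => X x ^ 2 * energy B A u x) :=
  ((h.contDiff_cutoff.continuous.pow 2).mul (continuous_energy h.contDiff_potential
    h.contDiff_field)).integrable_of_hasCompactSupport (h.hasCompactSupport_sq_mul _)

/-- The cutoff enters squared so that one factor `X` survives differentiation: then `|X| √energy`
can be absorbed by `X² energy`. -/
lemma abs_partialDeriv_sq_mul_le {ζ : E3 → ℝ} {M : ℝ} {x : E3} (hζ : DifferentiableAt ℝ ζ x)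
    (hM : |ζ x| ≤ M) (hM' : ∀ j, |partialDeriv j ζ x| ≤ M) (j : Fin 3) :
    |partialDeriv j (fun y => X y ^ 2 * ζ y) x| ≤ 3 * M * |X x| := by
  have dX : DifferentiableAt ℝ X x := h.contDiff_cutoff.differentiable (by norm_num) x
  have e : partialDeriv j (fun y => X y ^ 2 * ζ y) x
      = X x * (2 * partialDeriv j X x * ζ x + X x * partialDeriv j ζ x) := by
    simp only [pow_two]
    have d2 : DifferentiableAt ℝ (fun y => X y * X y) x := dX.mul dX
    rw [partialDeriv_mul d2 hζ, partialDeriv_mul dX dX]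
    ring
  have hM0 : 0 ≤ M := (abs_nonneg _).trans hM
  have h1 := h.abs_cutoff_le x
  have h2 := h.abs_partialDeriv_cutoff_le j x
  have h3 := hM' j
  rw [e, abs_mul, mul_comm (3 * M)]
  gcongr
  calc _ ≤ 2 * |partialDeriv j X x| * |ζ x| + |X x| * |partialDeriv j ζ x| := by
        refine (abs_add_le _ _).trans ?_
        simp [abs_mul]
    _ ≤ 2 * 1 * M + 1 * M := by gcongr
    _ = 3 * M := by ring

end IsAdmissible

/-- Absorption of lower-order terms. -/
lemma norm_setIntegral_le_of_lowerOrder {G : Type*} [NormedAddCommGroup G] [NormedSpace ℝ G]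
    (hΩ : MeasurableSet Ω) {X : E3 → ℝ} (h : IsAdmissible Ω A u X) {F : E3 → G} {K δ : ℝ}
    (hδ : 0 < δ)
    (hF : ∀ x ∈ Ω, ‖F x‖ ≤ K * (sqNorm u x + |X x| * (√(sqNorm u x) * √(energy B A u x)))) :
    ‖∫ x in Ω, F x‖ ≤ δ * (∫ x in Ω, X x ^ 2 * energy B A u x)
      + (K + K ^ 2 / (4 * δ)) * ∫ x in Ω, sqNorm u x := by
  have i1 := (h.integrable_sq_mul_energy (B := B)).integrableOn (s := Ω)
  have i2 := h.integrableOn_sqNorm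
  rw [← integral_const_mul, ← integral_const_mul, ← integral_add (i1.const_mul _) (i2.const_mul _)]
  refine norm_integral_le_of_norm_le ((i1.const_mul _).add (i2.const_mul _)) ?_
  refine (ae_restrict_iff' hΩ).2 (Eventually.of_forall fun x hx => (hF x hx).trans ?_)
  have hs := Real.sq_sqrt (sqNorm_nonneg (u := u) x)
  have he := Real.sq_sqrt (energy_nonneg (B := B) (A := A) (u := u) x)
  set s := √(sqNorm u x)
  set e := √(energy B A u x)
  rw [← hs, ← he, ← sq_abs (X x)]
  have := sq_nonneg (2 * δ * (|X x| * e) - K * s)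
  -- Young's inequality, by completing the square; `s` and `e` stand for |u| and |Du|.
  have h4 : K * (|X x| * (s * e)) ≤ δ * (|X x| ^ 2 * e ^ 2) + K ^ 2 / (4 * δ) * s ^ 2 := by
    rw [← sub_nonneg]
    have : δ * (|X x| ^ 2 * e ^ 2) + K ^ 2 / (4 * δ) * s ^ 2 - K * (|X x| * (s * e))
        = (2 * δ * (|X x| * e) - K * s) ^ 2 / (4 * δ) := by
      field_simp
      ring
    rw [this]
    positivity
  linarith

lemma IsControlled.add {ζ η : E3 → ℝ} (cζ : Continuous ζ)
    (cη : Continuous η) (hζ : IsControlled Ω ζ) (hη : IsControlled Ω η) :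
    IsControlled Ω (fun x => ζ x + η x) := by
  intro δ hδ
  obtain ⟨C₁, h₁⟩ := hζ (δ / 2) (by linarith)
  obtain ⟨C₂, h₂⟩ := hη (δ / 2) (by linarith)
  refine ⟨C₁ + C₂, fun B A u X h => ?_⟩
  have cQ := continuous_totalNull (B := B) h.contDiff_potential h.contDiff_field
  have cX := h.contDiff_cutoff.continuous
  have i : ∀ {ζ : E3 → ℝ}, Continuous ζ →
      IntegrableOn (fun x => ((X x ^ 2 * ζ x : ℝ) : ℂ) * totalNull B A u x) Ω := fun {ζ} cζ =>
    ((by fun_prop : Continuous _).integrable_of_hasCompactSupport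
      (hasCompactSupport_ofReal (h.hasCompactSupport_sq_mul ζ)).mul_right).integrableOn
  have e : ∀ x, ((X x ^ 2 * (ζ x + η x) : ℝ) : ℂ) * totalNull B A u x
      = ((X x ^ 2 * ζ x : ℝ) : ℂ) * totalNull B A u x
        + ((X x ^ 2 * η x : ℝ) : ℂ) * totalNull B A u x := by
    intro x; push_cast; ring
  simp only [e]
  rw [integral_add (i cζ) (i cη)]
  refine (norm_add_le _ _).trans ?_
  linarith [h₁ B A u X h, h₂ B A u X h]

/-- Weights that vanish near the boundary are controlled. -/
lemma isControlled_of_eventually_eq_zero (hΩ : IsOpen Ω) {ζ : E3 → ℝ} {M : ℝ} (hζ : ContDiff ℝ ∞ ζ)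
    (hM : ∀ x, |ζ x| ≤ M) (hM' : ∀ j x, |partialDeriv j ζ x| ≤ M)
    (h0 : ∀ x ∈ frontier Ω, ζ =ᶠ[𝓝 x] 0) : IsControlled Ω ζ := by
  intro δ hδ
  have hM0 : 0 ≤ M := (abs_nonneg _).trans (hM 0)
  -- 54 = 18 · 3, from `norm_fluxForm_le` and the bound `3 * M * |X x|` on the derivatives of the
  -- weight.
  refine ⟨54 * M + (54 * M) ^ 2 / (4 * δ), fun B A u X h => ?_⟩
  set ξ : E3 → ℝ := fun x => X x ^ 2 * ζ x with hξ
  -- Because `ζ` vanishes near the boundary, cutting off sharply at `Ω` yields a C¹ test function on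
  -- the whole space, and no boundary term arises.
  set φ : E3 → ℝ := Ω.indicator ξ with hφ
  have ξs : ContDiff ℝ 1 ξ := h.contDiff_sq_mul (by exact_mod_cast le_top)
    (hζ.of_le (by exact_mod_cast le_top))
  have hin : ∀ x ∈ Ω, φ =ᶠ[𝓝 x] ξ := fun x hx => by
    filter_upwards [hΩ.mem_nhds hx] with y hy
    simp [hφ, hy]
  have hout : ∀ x ∉ Ω, φ =ᶠ[𝓝 x] fun _ => 0 := fun x hx => by
    by_cases hxc : x ∈ closure Ω
    · filter_upwards [h0 x ⟨hxc, fun hi => hx (interior_subset hi)⟩] with y hy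
      simp [hφ, hξ, hy]
    · filter_upwards [isClosed_closure.isOpen_compl.mem_nhds hxc] with y hy
      exact Set.indicator_of_notMem (fun hyΩ => hy (subset_closure hyΩ)) _
  have φs : ContDiff ℝ 1 φ := contDiff_iff_contDiffAt.2 fun x => by
    by_cases hx : x ∈ Ω
    · exact (ξs.contDiffAt).congr_of_eventuallyEq (hin x hx)
    · exact contDiffAt_const.congr_of_eventuallyEq (hout x hx)
  have φc : HasCompactSupport φ := (h.hasCompactSupport_sq_mul ζ).mono' (by
    intro x hx
    refine subset_tsupport _ ?_
    simp only [Function.mem_support] at hx ⊢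
    exact fun h' => hx (Set.indicator_apply_eq_zero.2 fun _ => h'))
  have key := integral_mul_totalNull (B := B) h.contDiff_potential h.contDiff_field φs φc
  have e1 : ∫ x, (φ x : ℂ) * totalNull B A u x
      = ∫ x in Ω, (ξ x : ℂ) * totalNull B A u x := by
    rw [← integral_indicator hΩ.measurableSet]
    congr 1
    ext x
    by_cases hx : x ∈ Ω <;> simp [hφ, hx]
  have e2 : ∫ x, fluxForm B A u (fun j => partialDeriv j φ x) x
      = ∫ x in Ω, fluxForm B A u (fun j => partialDeriv j φ x) x := by
    refine (setIntegral_eq_integral_of_forall_compl_eq_zero fun x hx => ?_).symm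
    have : ∀ j, partialDeriv j φ x = 0 := fun j => by
      rw [partialDeriv_congr (hout x hx)]
      simp [partialDeriv]
    simp [fluxForm, this]
  rw [← e1, key, e2, norm_mul, Complex.norm_I, one_mul]
  refine norm_setIntegral_le_of_lowerOrder hΩ.measurableSet h hδ fun x hx => ?_
  have hp : ∀ j, |partialDeriv j φ x| ≤ 3 * M * |X x| := fun j => by
    rw [partialDeriv_congr (hin x hx)]
    exact h.abs_partialDeriv_sq_mul_le (hζ.differentiable (by norm_num) x) (hM x)
      (fun j => hM' j x) j
  refine (norm_fluxForm_le hp x).trans ?_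
  have := sqNorm_nonneg (u := u) x
  nlinarith [mul_nonneg hM0 this]

end Weighted

/-! ### Boundary charts and the vanishing of the normal component -/

section Chart

lemma gradient_apply_eq_partialDeriv (ρ : E3 → ℝ) (x : E3) (j : Fin 3) :
    (∇ ρ x) j = partialDeriv j ρ x := by
  rw [partialDeriv, ← toDual_gradient (𝕜 := ℝ), InnerProductSpace.toDual_apply_apply,
    EuclideanSpace.inner_single_right]
  simp

lemma gradient_ne_zero_of_partialDeriv_ne_zero {ρ : E3 → ℝ} {x : E3} {j : Fin 3}
    (h : partialDeriv j ρ x ≠ 0) : ∇ ρ x ≠ 0 := by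
  intro h0
  rw [← gradient_apply_eq_partialDeriv, h0] at h
  simp at h

lemma exists_partialDeriv_ne_zero {ρ : E3 → ℝ} {x : E3} (h : ∇ ρ x ≠ 0) :
    ∃ j, partialDeriv j ρ x ≠ 0 := by
  by_contra! h0
  apply h
  ext j
  simpa [h0] using gradient_apply_eq_partialDeriv ρ x j

/-- A defining function of `Ω` on the ball of radius `2 * r` about `x₀` that is smooth on the whole
space and strictly monotone in the direction of the `l`-th coordinate axis. -/
structure IsBoundaryChart (Ω : Set E3) (x₀ : E3) (r : ℝ) (ρ : E3 → ℝ) (l : Fin 3) (s c : ℝ) :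
    Prop where
  radius_pos : 0 < r
  contDiff : ContDiff ℝ ∞ ρ
  slope_pos : 0 < c
  abs_sign : |s| = 1
  le_slope : ∀ x ∈ Metric.ball x₀ (2 * r), c ≤ s * partialDeriv l ρ x
  mem_iff : ∀ x ∈ Metric.ball x₀ (2 * r), x ∈ Ω ↔ ρ x < 0

/-- Some partial derivative of the defining function is nonzero at `x₀`; by continuity it keeps its
sign and at least half its size nearby. A bump function extends the defining function smoothly to
the whole space without changing it near `x₀`. -/
lemma exists_isBoundaryChart {Ω : Set E3} (hΩ : IsSmoothDomain Ω) {x₀ : E3}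
    (hx₀ : x₀ ∈ frontier Ω) : ∃ r ρ l s c, IsBoundaryChart Ω x₀ r ρ l s c := by
  obtain ⟨U, ρ₀, h⟩ := hΩ.smooth_boundary x₀ hx₀
  obtain ⟨R, hR, hRU⟩ := Metric.nhds_basis_closedBall.mem_iff.1 (h.isOpen.mem_nhds h.mem)
  let b : ContDiffBump x₀ := ⟨R / 2, R, by positivity, by linarith⟩
  set ρ : E3 → ℝ := fun x => b x * ρ₀ x with hρ
  have bs : ContDiff ℝ ∞ b := b.contDiff
  have hs : ContDiff ℝ ∞ ρ := by
    refine contDiff_iff_contDiffAt.2 fun x => ?_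
    by_cases hx : x ∈ U
    · exact bs.contDiffAt.mul (h.contDiffOn.contDiffAt (h.isOpen.mem_nhds hx))
    · have hx' : x ∉ tsupport b := fun hx' => hx (hRU (by simpa [b.tsupport_eq] using hx'))
      refine (contDiffAt_const (c := (0 : ℝ))).congr_of_eventuallyEq ?_
      filter_upwards [(isClosed_tsupport b).isOpen_compl.mem_nhds hx'] with y hy
      simp [hρ, image_eq_zero_of_notMem_tsupport hy]
  have hloc : ∀ x ∈ Metric.ball x₀ (R / 2), ρ x = ρ₀ x := fun x hx => by
    simp [hρ, b.one_of_mem_closedBall (Metric.ball_subset_closedBall hx)]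
  obtain ⟨l, hl⟩ := exists_partialDeriv_ne_zero h.gradient_ne_zero
  have hl' : partialDeriv l ρ x₀ = partialDeriv l ρ₀ x₀ := partialDeriv_congr (by
    filter_upwards [Metric.ball_mem_nhds x₀ (by positivity : 0 < R / 2)] with y hy
      using hloc y hy) l
  set d := partialDeriv l ρ₀ x₀ with hd
  have hd0 : 0 < |d| := abs_pos.2 hl
  have hcont : Continuous (fun x => SignType.sign d * partialDeriv l ρ x) :=
    continuous_const.mul (continuous_partialDeriv (hs.of_le (by exact_mod_cast le_top)) l)
  have hmem : {x | |d| / 2 < SignType.sign d * partialDeriv l ρ x} ∈ 𝓝 x₀ := by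
    refine (isOpen_lt continuous_const hcont).mem_nhds ?_
    simp only [mem_ofPred_eq, hl', sign_mul_self]
    linarith
  obtain ⟨R₂, hR₂, hball⟩ := Metric.mem_nhds_iff.1 hmem
  have hsub : Metric.ball x₀ (2 * (min (R / 2) R₂ / 2)) ⊆
      Metric.ball x₀ (R / 2) ∩ Metric.ball x₀ R₂ := by
    rw [mul_div_cancel₀ _ (two_ne_zero)]
    exact subset_inter (Metric.ball_subset_ball (min_le_left _ _))
      (Metric.ball_subset_ball (min_le_right _ _))
  -- The radius is halved because the chart conditions are required on the ball of radius `2 * r`.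
  refine ⟨min (R / 2) R₂ / 2, ρ, l, SignType.sign d, |d| / 2, by positivity, hs, by positivity,
    ?_, fun x hx => (hball (hsub hx).2).le, fun x hx => ?_⟩
  · rcases hl.lt_or_gt with h' | h' <;> simp [h']
  · have hxb := (hsub hx).1
    have hxU : x ∈ U := hRU (Metric.ball_subset_closedBall
      (Metric.ball_subset_ball (by linarith) hxb))
    rw [hloc x hxb]
    have := congrArg (x ∈ ·) h.inter_eq
    simpa [hxU] using this

namespace IsBoundaryChart

variable {Ω : Set E3} {x₀ : E3} {r : ℝ} {ρ : E3 → ℝ} {l : Fin 3} {s c : ℝ}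
  (h : IsBoundaryChart Ω x₀ r ρ l s c)
include h

lemma contDiff_one : ContDiff ℝ 1 ρ := h.contDiff.of_le (by exact_mod_cast le_top)

lemma partialDeriv_ne_zero {x : E3} (hx : x ∈ Metric.ball x₀ (2 * r)) :
    partialDeriv l ρ x ≠ 0 := by
  intro h0
  have h1 := h.le_slope x hx
  have h2 := h.slope_pos
  rw [h0, mul_zero] at h1
  linarith

/-- A zero of `ρ` outside the closure of `Ω` would be a local minimum of `ρ`, contradicting the
nonzero slope. Tangentiality is assumed at frontier points only, so this is what makes it available
on all of `ρ = 0` in the chart. -/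
lemma mem_frontier {x : E3} (hx : x ∈ Metric.ball x₀ (2 * r)) (h0 : ρ x = 0) :
    x ∈ frontier Ω := by
  refine ⟨?_, fun hi => by have := (h.mem_iff x hx).1 (interior_subset hi); linarith⟩
  by_contra hxc
  have hmin : IsLocalMin ρ x := by
    filter_upwards [isClosed_closure.isOpen_compl.mem_nhds hxc,
      Metric.isOpen_ball.mem_nhds hx] with y hy hyb
    rw [h0]
    by_contra! hlt
    exact hy (subset_closure ((h.mem_iff y hyb).2 hlt))
  exact h.partialDeriv_ne_zero hx (by simp [partialDeriv, hmin.fderiv_eq_zero])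

lemma isDefiningFunctionNear {x : E3} (hx : x ∈ Metric.ball x₀ (2 * r)) :
    IsDefiningFunctionNear Ω x (Metric.ball x₀ (2 * r)) ρ where
  isOpen := Metric.isOpen_ball
  mem := hx
  contDiffOn := h.contDiff.contDiffOn
  gradient_ne_zero := gradient_ne_zero_of_partialDeriv_ne_zero (h.partialDeriv_ne_zero hx)
  inter_eq := by
    ext y
    constructor
    · exact fun hy => ⟨hy.2, (h.mem_iff y hy.2).1 hy.1⟩
    · exact fun hy => ⟨(h.mem_iff y hy.1).2 hy.2, hy.1⟩

lemma normalComponent_eq_zero {u : Fin 3 → E3 → ℂ} (hu : IsTangential Ω u) {x : E3}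
    (hx : x ∈ Metric.ball x₀ (2 * r)) (h0 : ρ x = 0) :
    ∑ j, (partialDeriv j ρ x : ℝ) * u j x = 0 := by
  have hd := h.isDefiningFunctionNear hx
  have := hu x _ ⟨h.mem_frontier hx h0, _, _, hd, rfl⟩
  have hn : ((‖∇ ρ x‖⁻¹ : ℝ) : ℂ) ≠ 0 := by
    exact_mod_cast inv_ne_zero (norm_ne_zero_iff.2 hd.gradient_ne_zero)
  have e : ∀ j, (((‖∇ ρ x‖⁻¹ • ∇ ρ x) j : ℝ) : ℂ) * u j x
      = ((‖∇ ρ x‖⁻¹ : ℝ) : ℂ) * ((partialDeriv j ρ x : ℝ) * u j x) := fun j => by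
    rw [← gradient_apply_eq_partialDeriv]
    simp only [PiLp.smul_apply, smul_eq_mul, Complex.ofReal_mul]
    ring
  simp only [e, ← Finset.mul_sum] at this
  exact (mul_eq_zero.1 this).resolve_left hn

/-- A `C¹` function that vanishes on the hypersurface is bounded by a multiple of the defining
function. -/
lemma exists_norm_le_mul_abs {w : E3 → ℂ} (hw : ContDiff ℝ 1 w)
    (hw0 : ∀ x ∈ Metric.ball x₀ (2 * r), ρ x = 0 → w x = 0) :
    ∃ C, 0 ≤ C ∧ ∀ x ∈ Metric.ball x₀ r, ρ x < 0 → ‖w x‖ ≤ C * |ρ x| := by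
  have hr := h.radius_pos
  have hc := h.slope_pos
  obtain ⟨L, hL⟩ := (isCompact_closedBall x₀ (2 * r)).exists_bound_of_continuousOn
    (hw.continuous_fderiv (by norm_num)).continuousOn
  obtain ⟨N, hN⟩ := (isCompact_closedBall x₀ (2 * r)).exists_bound_of_continuousOn
    hw.continuous.continuousOn
  have hmem0 : x₀ ∈ Metric.closedBall x₀ (2 * r) := Metric.mem_closedBall_self (by positivity)
  have hL0 : 0 ≤ L := (norm_nonneg _).trans (hL x₀ hmem0)
  have hN0 : 0 ≤ N := (norm_nonneg _).trans (hN x₀ hmem0)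
  -- The first summand serves the points with `|ρ x| ≥ c * r`, where the bound `N` on `w` suffices;
  -- the second serves the points near the hypersurface.
  refine ⟨N / (c * r) + L / c, by positivity, fun x hx hneg => ?_⟩
  have hρ : |ρ x| = -ρ x := abs_of_neg hneg
  have hxball : x ∈ Metric.ball x₀ (2 * r) := Metric.ball_subset_ball (by linarith) hx
  rcases le_or_gt (c * r) |ρ x| with hbig | hsmall
  · have h1 : ‖w x‖ ≤ N := hN x (Metric.ball_subset_closedBall hxball)
    have h2 : N ≤ N / (c * r) * |ρ x| := by
      rw [div_mul_eq_mul_div, le_div_iff₀ (by positivity)]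
      gcongr
    have : 0 ≤ L / c * |ρ x| := by positivity
    linarith
  -- Along the axis direction `ρ` grows at rate at least `c`, so it reaches zero within distance `T
  -- < r`, before the path leaves the ball of radius `2 * r`. The gradient bound `L` on that segment
  -- then controls `w x`.
  set T := |ρ x| / c with hT
  have hT0 : 0 ≤ T := by positivity
  have hTr : T < r := by rw [hT, div_lt_iff₀ hc]; linarith
  set v : E3 := s • EuclideanSpace.single l 1 with hv
  have hvn : ‖v‖ = 1 := by simp [hv, norm_smul, h.abs_sign]
  have hin : ∀ τ ∈ Icc 0 T, x + τ • v ∈ Metric.ball x₀ (2 * r) := by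
    intro τ hτ
    rw [Metric.mem_ball, dist_eq_norm] at hx ⊢
    have : ‖x + τ • v - x₀‖ ≤ ‖x - x₀‖ + ‖τ • v‖ := by
      rw [add_sub_right_comm]; exact norm_add_le _ _
    rw [norm_smul, hvn, mul_one, Real.norm_eq_abs, abs_of_nonneg hτ.1] at this
    linarith [hτ.2]
  have hder : ∀ τ, HasDerivAt (fun τ : ℝ => ρ (x + τ • v)) (s * partialDeriv l ρ (x + τ • v)) τ := by
    intro τ
    have h1 : HasDerivAt (fun τ : ℝ => x + τ • v) v τ := by
      simpa using ((hasDerivAt_id τ).smul_const v).const_add x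
    have h2 := (h.contDiff_one.differentiable (by norm_num) (x + τ • v)).hasFDerivAt.comp_hasDerivAt τ h1
    have e : (fderiv ℝ ρ (x + τ • v)) v = s * partialDeriv l ρ (x + τ • v) := by
      rw [hv, map_smul]; rfl
    rwa [e] at h2
  have hcont : Continuous fun τ : ℝ => ρ (x + τ • v) :=
    continuous_iff_continuousAt.2 fun τ => (hder τ).continuousAt
  have hinc := (convex_Icc 0 T).mul_sub_le_image_sub_of_le_deriv hcont.continuousOn
    (fun τ _ => (hder τ).differentiableAt.differentiableWithinAt) (C := c) (fun τ hτ => by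
      rw [(hder τ).deriv]
      exact h.le_slope _ (hin τ (interior_subset hτ))) 0 (left_mem_Icc.2 hT0) T
      (right_mem_Icc.2 hT0) hT0
  have hT1 : 0 ≤ ρ (x + T • v) := by
    have : c * T = |ρ x| := by rw [hT]; field_simp
    simp only [sub_zero, zero_smul, add_zero, this] at hinc
    linarith
  obtain ⟨τ, hτ, hτ0⟩ := intermediate_value_Icc hT0 hcont.continuousOn
    (show (0 : ℝ) ∈ Icc _ _ from ⟨by simpa using hneg.le, hT1⟩)
  have hseg := (convex_ball x₀ (2 * r)).norm_image_sub_le_of_norm_fderiv_le (𝕜 := ℝ) (f := w)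
    (fun y _ => hw.differentiable (by norm_num) y)
    (fun y hy => hL y (Metric.ball_subset_closedBall hy)) (hin τ hτ) hxball
  rw [hw0 _ (hin τ hτ) hτ0, sub_zero, sub_add_cancel_left, norm_neg, norm_smul, hvn, mul_one,
    Real.norm_eq_abs, abs_of_nonneg hτ.1] at hseg
  calc ‖w x‖ ≤ L * T := hseg.trans (by gcongr; exact hτ.2)
    _ = L / c * |ρ x| := by rw [hT]; ring
    _ ≤ (N / (c * r) + L / c) * |ρ x| := by
        gcongr
        exact le_add_of_nonneg_left (by positivity)

end IsBoundaryChart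

end Chart

/-! ### Limits of integrals over thin layers -/

section Layer

lemma deriv_smoothTransition_nonneg (t : ℝ) : 0 ≤ deriv Real.smoothTransition t :=
  Real.smoothTransition.monotone.deriv_nonneg

lemma deriv_smoothTransition_of_nonpos {t : ℝ} (ht : t ≤ 0) : deriv Real.smoothTransition t = 0 :=
  IsLocalMin.deriv_eq_zero (Eventually.of_forall fun y => by
    rw [Real.smoothTransition.zero_of_nonpos ht]; exact Real.smoothTransition.nonneg y)

lemma deriv_smoothTransition_of_one_le {t : ℝ} (ht : 1 ≤ t) : deriv Real.smoothTransition t = 0 :=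
  IsLocalMax.deriv_eq_zero (Eventually.of_forall fun y => by
    rw [Real.smoothTransition.one_of_one_le ht]; exact Real.smoothTransition.le_one y)

/-- A zero of the nonnegative function `deriv Real.smoothTransition` is a minimum. Hence the second
derivative too vanishes outside the unit interval, as `tendsto_integral_layer` requires. -/
lemma deriv_deriv_smoothTransition_of_deriv_eq_zero {t : ℝ} (ht : deriv Real.smoothTransition t = 0) :
    deriv (deriv Real.smoothTransition) t = 0 :=
  IsLocalMin.deriv_eq_zero (Eventually.of_forall fun y => by
    rw [ht]; exact deriv_smoothTransition_nonneg y)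

lemma contDiff_deriv_smoothTransition : ContDiff ℝ 1 (deriv Real.smoothTransition) :=
  (Real.smoothTransition.contDiff (n := 2)).deriv'

/-- Integrals over the layers `-2/n ≤ ρ ≤ -1/n` tend to zero if the integrand vanishes on `ρ = 0` to
the order of its weight. -/
lemma tendsto_integral_layer {ρ : E3 → ℝ} (hρ : Continuous ρ) {F : ℝ → ℝ} (hF : Continuous F)
    (hF0 : ∀ t ≤ 0, F t = 0) (hF1 : ∀ t, 1 ≤ t → F t = 0) {G : E3 → ℂ} (hG : Continuous G)
    (hc : HasCompactSupport G) {C : ℝ} {k : ℕ} (hGC : ∀ x, ρ x < 0 → ‖G x‖ ≤ C * |ρ x| ^ k) :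
    Tendsto (fun n : ℕ => ∫ x, (((n : ℝ) ^ k * F (-n * ρ x - 1) : ℝ) : ℂ) * G x) atTop (𝓝 0) := by
  obtain ⟨M, hM⟩ := (isCompact_Icc (a := (0 : ℝ)) (b := 1)).exists_bound_of_continuousOn
    hF.continuousOn
  have hM0 : 0 ≤ M := (norm_nonneg _).trans (hM 0 (by simp))
  rw [← integral_zero E3 ℂ (μ := volume)]
  refine tendsto_integral_of_dominated_convergence
    ((tsupport G).indicator fun _ => M * |C| * 2 ^ k) ?_ ?_ ?_ ?_
  · intro n
    exact (by fun_prop : Continuous _).aestronglyMeasurable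
  · exact (integrable_indicator_iff (isClosed_tsupport G).measurableSet).2
      (integrableOn_const (hc.isCompact.measure_lt_top.ne))
  · intro n
    refine Eventually.of_forall fun x => ?_
    by_cases hx : x ∈ tsupport G
    swap
    · simp [hx, image_eq_zero_of_notMem_tsupport hx]
    rw [Set.indicator_of_mem hx]
    rcases le_or_gt (-n * ρ x - 1) 0 with h0 | h0
    · rw [hF0 _ h0]; simp; positivity
    rcases le_or_gt 1 (-n * ρ x - 1) with h1 | h1
    · rw [hF1 _ h1]; simp; positivity
    have hneg : ρ x < 0 := by
      by_contra! hp
      have : 0 ≤ (n : ℝ) * ρ x := by positivity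
      linarith
    rw [norm_mul, Complex.norm_real, norm_mul, norm_pow, Real.norm_natCast]
    -- On the layer the weight `n ^ k` exactly compensates the vanishing of `G` to order `k`, which
    -- gives a bound uniform in `n`.
    have hnρ : (n : ℝ) * |ρ x| ≤ 2 := by rw [abs_of_neg hneg]; linarith
    calc (n : ℝ) ^ k * ‖F (-n * ρ x - 1)‖ * ‖G x‖ ≤ (n : ℝ) ^ k * M * (|C| * |ρ x| ^ k) := by
          gcongr
          · exact hM _ ⟨h0.le, h1.le⟩
          · exact (hGC x hneg).trans (by gcongr; exact le_abs_self C)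
      _ = M * |C| * ((n : ℝ) * |ρ x|) ^ k := by ring
      _ ≤ M * |C| * 2 ^ k := by gcongr
  · refine Eventually.of_forall fun x => ?_
    refine tendsto_const_nhds.congr' ?_
    rcases le_or_gt 0 (ρ x) with hp | hneg
    · refine Eventually.of_forall fun n => ?_
      have : 0 ≤ (n : ℝ) * ρ x := by positivity
      beta_reduce
      rw [hF0 (-n * ρ x - 1) (by linarith)]
      simp
    · obtain ⟨N, hN⟩ := exists_nat_ge (2 / -ρ x)
      filter_upwards [eventually_ge_atTop N] with n hn
      have h2 : 2 ≤ (n : ℝ) * -ρ x := by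
        rw [div_le_iff₀ (by linarith)] at hN
        have : (N : ℝ) ≤ n := by exact_mod_cast hn
        nlinarith
      rw [hF1 (-n * ρ x - 1) (by linarith)]
      simp

/-- The smooth cutoffs `smoothTransition (-n ρ - 1)` tend to the indicator function of `ρ < 0`. -/
lemma tendsto_integral_cutoff {ρ : E3 → ℝ} (hρ : Continuous ρ) {Ω : Set E3} (hΩ : MeasurableSet Ω)
    {G : E3 → ℂ} (hG : Continuous G) (hc : HasCompactSupport G)
    (hGΩ : ∀ x, G x ≠ 0 → (x ∈ Ω ↔ ρ x < 0)) :
    Tendsto (fun n : ℕ => ∫ x, (Real.smoothTransition (-n * ρ x - 1) : ℂ) * G x) atTop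
      (𝓝 (∫ x in Ω, G x)) := by
  have hf := Real.smoothTransition.continuous
  rw [← integral_indicator hΩ]
  refine tendsto_integral_of_dominated_convergence (fun x => ‖G x‖) ?_
    (hG.integrable_of_hasCompactSupport hc).norm ?_ ?_
  · intro n
    exact (by fun_prop : Continuous _).aestronglyMeasurable
  · intro n
    refine Eventually.of_forall fun x => ?_
    rw [norm_mul, Complex.norm_real, Real.norm_eq_abs,
      abs_of_nonneg (Real.smoothTransition.nonneg _)]
    exact mul_le_of_le_one_left (norm_nonneg _) (Real.smoothTransition.le_one _)
  · refine Eventually.of_forall fun x => ?_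
    by_cases hx : G x = 0
    · simp [hx, Set.indicator_apply_eq_zero.2 fun _ => hx]
    refine tendsto_const_nhds.congr' ?_
    rcases le_or_gt 0 (ρ x) with hp | hneg
    · have hxΩ : x ∉ Ω := fun h => absurd ((hGΩ x hx).1 h) (not_lt.2 hp)
      refine Eventually.of_forall fun n => ?_
      have : 0 ≤ (n : ℝ) * ρ x := by positivity
      beta_reduce
      rw [Real.smoothTransition.zero_of_nonpos (show -n * ρ x - 1 ≤ 0 by linarith)]
      simp [hxΩ]
    · have hxΩ : x ∈ Ω := (hGΩ x hx).2 hneg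
      obtain ⟨N, hN⟩ := exists_nat_ge (2 / -ρ x)
      filter_upwards [eventually_ge_atTop N] with n hn
      have h2 : 2 ≤ (n : ℝ) * -ρ x := by
        rw [div_le_iff₀ (by linarith)] at hN
        have : (N : ℝ) ≤ n := by exact_mod_cast hn
        nlinarith
      rw [Real.smoothTransition.one_of_one_le (show 1 ≤ -n * ρ x - 1 by linarith)]
      simp [hxΩ]

end Layer

/-! ### The current along the gradient of a defining function -/

section FluxIdentity

variable {B : ℝ} {A : E3 → E3} {u : Fin 3 → E3 → ℂ} {ρ : E3 → ℝ}

/-- The derivative of `ρ` along `u`. -/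
def normalComponent (ρ : E3 → ℝ) (u : Fin 3 → E3 → ℂ) (x : E3) : ℂ :=
  ∑ j, (partialDeriv j ρ x : ℝ) * u j x

/-- The covariant divergence of `u`. -/
def magDivergence (B : ℝ) (A : E3 → E3) (u : Fin 3 → E3 → ℂ) (x : E3) : ℂ :=
  ∑ j, magDeriv B A j (u j) x

/-- The Hessian of `ρ` evaluated on `u` and its conjugate. -/
def hessianForm (ρ : E3 → ℝ) (u : Fin 3 → E3 → ℂ) (x : E3) : ℂ :=
  ∑ k, ∑ j, (partialDeriv k (partialDeriv j ρ) x : ℝ) * (u k x * conj (u j x))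

lemma contDiff_normalComponent (hρ : ContDiff ℝ 2 ρ) (hu : ∀ k, ContDiff ℝ 1 (u k)) :
    ContDiff ℝ 1 (normalComponent ρ u) :=
  ContDiff.sum fun j _ =>
    (contDiff_ofReal (contDiff_partialDeriv (m := 1) hρ (by norm_num) j)).mul (hu j)

lemma continuous_magDivergence (hA : Continuous A) (hu : ∀ k, ContDiff ℝ 1 (u k)) :
    Continuous (magDivergence B A u) :=
  continuous_finsetSum _ fun j _ => continuous_magDeriv hA (hu j) j

lemma continuous_hessianForm (hρ : ContDiff ℝ 2 ρ) (hu : ∀ k, ContDiff ℝ 1 (u k)) :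
    Continuous (hessianForm ρ u) := by
  have h1 := fun k j => continuous_partialDeriv
    (contDiff_partialDeriv (m := 1) hρ (by norm_num) j) k
  have h2 := fun k => (hu k).continuous
  unfold hessianForm
  fun_prop

lemma continuous_normalComponent (hρ : ContDiff ℝ 1 ρ) (hu : ∀ k, Continuous (u k)) :
    Continuous (normalComponent ρ u) := by
  have h1 := continuous_partialDeriv hρ
  unfold normalComponent
  fun_prop

lemma continuous_fluxForm (hA : Continuous A) (hu : ∀ k, ContDiff ℝ 1 (u k)) {p : E3 → Fin 3 → ℝ}
    (hp : ∀ j, Continuous fun x => p x j) : Continuous (fun x => fluxForm B A u (p x) x) := by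
  have h1 := fun j k => continuous_magDeriv (B := B) hA (hu k) j
  have h2 := fun k => (hu k).continuous
  unfold fluxForm
  fun_prop

lemma fluxForm_linear (a b : ℝ) (p q : Fin 3 → ℝ) (x : E3) :
    fluxForm B A u (fun j => a * p j + b * q j) x
      = a * fluxForm B A u p x + b * fluxForm B A u q x := by
  simp only [fluxForm, Finset.mul_sum, ← Finset.sum_add_distrib]
  refine Finset.sum_congr rfl fun j _ => Finset.sum_congr rfl fun k _ => ?_
  push_cast
  ring

/-- Leibniz's rule for `D_k` applied to `∇ρ · u`: pulling `∇ρ` inside the derivative costs the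
Hessian. What remains involves only the normal component, which vanishes on the boundary for
tangential `u`. -/
lemma fluxForm_partialDeriv (hρ : ContDiff ℝ 2 ρ) (hu : ∀ k, ContDiff ℝ 1 (u k)) (x : E3) :
    fluxForm B A u (fun j => partialDeriv j ρ x) x
      = ∑ k, u k x * conj (magDeriv B A k (normalComponent ρ u) x)
        - Complex.I * hessianForm ρ u x
        - normalComponent ρ u x * conj (magDivergence B A u x) := by
  have hp : ∀ j, ContDiff ℝ 1 (partialDeriv j ρ) := fun j =>
    contDiff_partialDeriv (m := 1) hρ (by norm_num) j
  have dp : ∀ j, DifferentiableAt ℝ (fun y => ((partialDeriv j ρ y : ℝ) : ℂ)) x := fun j =>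
    (contDiff_ofReal (hp j)).differentiable (by norm_num) x
  have du : ∀ j, DifferentiableAt ℝ (u j) x := fun j => (hu j).differentiable (by norm_num) x
  have e : ∀ k, magDeriv B A k (normalComponent ρ u) x = ∑ j, ((partialDeriv j ρ x : ℝ)
      * magDeriv B A k (u j) x
      - Complex.I * (partialDeriv k (partialDeriv j ρ) x : ℝ) * u j x) := by
    intro k
    unfold normalComponent
    have dm : ∀ j ∈ Finset.univ, DifferentiableAt ℝ
        (fun y => ((partialDeriv j ρ y : ℝ) : ℂ) * u j y) x := fun j _ => (dp j).mul (du j)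
    rw [magDeriv_sum dm]
    refine Finset.sum_congr rfl fun j _ => ?_
    rw [magDeriv_mul (dp j) (du j), partialDeriv_ofReal ((hp j).differentiable (by norm_num) x)]
  simp only [e, fluxForm, hessianForm, normalComponent, magDivergence, Fin.sum_univ_three,
    map_add, map_sub, map_mul, Complex.conj_I, Complex.conj_ofReal]
  ring

/-- Integration by parts of the current against a gradient. -/
lemma integral_mul_fluxForm {η : E3 → ℝ} (hA : ContDiff ℝ 1 A) (hρ : ContDiff ℝ 2 ρ)
    (hu : ∀ k, ContDiff ℝ 1 (u k)) (hη : ContDiff ℝ 1 η) (hc : HasCompactSupport η) :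
    ∫ x, (η x : ℂ) * fluxForm B A u (fun j => partialDeriv j ρ x) x
      = ∫ x, ((η x * magDivergence B A u x - Complex.I * normalComponent η u x)
            * conj (normalComponent ρ u x)
          - η x * normalComponent ρ u x * conj (magDivergence B A u x)
          - Complex.I * (η x * hessianForm ρ u x)) := by
  have hw := contDiff_normalComponent hρ hu
  have cu := fun k => (hu k).continuous
  have cη := hη.continuous
  have cw := hw.continuous
  have cd := continuous_magDivergence (B := B) hA.continuous hu
  have cH := continuous_hessianForm hρ hu
  have cn := continuous_normalComponent hη cu
  have cD := fun k => continuous_magDeriv (B := B) hA.continuous hw k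
  have hηc := contDiff_ofReal hη
  have hcc := hasCompactSupport_ofReal hc
  have hηu : ∀ k, ContDiff ℝ 1 (fun x => (η x : ℂ) * u k x) := fun k => hηc.mul (hu k)
  have cηu := fun k => continuous_magDeriv (B := B) hA.continuous (hηu k) k
  have hcu : ∀ k, HasCompactSupport (fun x => (η x : ℂ) * u k x) := fun k => hcc.mul_right
  have cDηu : ∀ k, HasCompactSupport (magDeriv B A k (fun x => (η x : ℂ) * u k x)) := fun k =>
    ((hasCompactSupport_partialDeriv (hcu k) k).mul_left).add (hcu k).mul_left
  have e1 : ∀ k x, magDeriv B A k (fun x => (η x : ℂ) * u k x) x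
      = η x * magDeriv B A k (u k) x - Complex.I * (partialDeriv k η x : ℝ) * u k x := fun k x => by
    rw [magDeriv_mul (hηc.differentiable (by norm_num) x) ((hu k).differentiable (by norm_num) x),
      partialDeriv_ofReal (hη.differentiable (by norm_num) x)]
  have e2 : ∀ x, ∑ k, magDeriv B A k (fun x => (η x : ℂ) * u k x) x
      = η x * magDivergence B A u x - Complex.I * normalComponent η u x := fun x => by
    simp only [e1, Finset.sum_sub_distrib, magDivergence, normalComponent, Finset.mul_sum,
      mul_assoc]
  have i1 : ∀ k, Integrable (fun x => (η x : ℂ) * u k x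
      * conj (magDeriv B A k (normalComponent ρ u) x)) := fun k =>
    (by fun_prop : Continuous _).integrable_of_hasCompactSupport (hcu k).mul_right
  have i2 : ∀ k, Integrable (fun x => magDeriv B A k (fun x => (η x : ℂ) * u k x) x
      * conj (normalComponent ρ u x)) := fun k =>
    (by fun_prop : Continuous _).integrable_of_hasCompactSupport (cDηu k).mul_right
  have i3 : Integrable (fun x => (η x : ℂ) * (-normalComponent ρ u x
      * conj (magDivergence B A u x) - Complex.I * hessianForm ρ u x)) :=
    (by fun_prop : Continuous _).integrable_of_hasCompactSupport hcc.mul_right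
  calc _ = ∫ x, (∑ k, (η x : ℂ) * u k x * conj (magDeriv B A k (normalComponent ρ u) x)
          + (η x : ℂ) * (-normalComponent ρ u x * conj (magDivergence B A u x)
            - Complex.I * hessianForm ρ u x)) := by
        congr 1
        ext x
        rw [fluxForm_partialDeriv hρ hu]
        simp only [mul_assoc, ← Finset.mul_sum]
        ring
    _ = ∫ x, (∑ k, magDeriv B A k (fun x => (η x : ℂ) * u k x) x * conj (normalComponent ρ u x)
          + (η x : ℂ) * (-normalComponent ρ u x * conj (magDivergence B A u x)
            - Complex.I * hessianForm ρ u x)) := by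
        rw [integral_add (integrable_finsetSum _ fun k _ => i1 k) i3,
          integral_add (integrable_finsetSum _ fun k _ => i2 k) i3,
          integral_finsetSum _ fun k _ => i1 k, integral_finsetSum _ fun k _ => i2 k]
        congr 1
        exact Finset.sum_congr rfl fun k _ =>
          integral_mul_conj_magDeriv hA.continuous (hηu k) hw (hcu k) k
    _ = _ := by
        congr 1
        ext x
        rw [← Finset.sum_mul, e2]
        ring

end FluxIdentity

/-! ### Derivatives of the layer cutoffs -/

section LayerDerivatives

variable {ρ : E3 → ℝ}

/-- Smooth cutoff functions that tend to the indicator function of `ρ < 0`. -/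
def layerCutoff (ρ : E3 → ℝ) (n : ℕ) (x : E3) : ℝ := Real.smoothTransition (-n * ρ x - 1)

/-- The slope of `layerCutoff` with respect to `-ρ`. -/
def layerSlope (ρ : E3 → ℝ) (n : ℕ) (x : E3) : ℝ :=
  n * deriv Real.smoothTransition (-n * ρ x - 1)

lemma layerSlope_nonneg (n : ℕ) (x : E3) : 0 ≤ layerSlope ρ n x :=
  mul_nonneg (Nat.cast_nonneg n) (deriv_smoothTransition_nonneg _)

lemma layerCutoff_eq_zero {n : ℕ} {x : E3} (h : 0 ≤ ρ x) : layerCutoff ρ n x = 0 := by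
  have : 0 ≤ (n : ℝ) * ρ x := by positivity
  exact Real.smoothTransition.zero_of_nonpos (by linarith)

lemma abs_layerCutoff_le (n : ℕ) (x : E3) : |layerCutoff ρ n x| ≤ 1 :=
  abs_le.2 ⟨by linarith [Real.smoothTransition.nonneg (-n * ρ x - 1),
    show layerCutoff ρ n x = Real.smoothTransition (-n * ρ x - 1) from rfl],
    Real.smoothTransition.le_one _⟩

lemma contDiff_layerCutoff (hρ : ContDiff ℝ 1 ρ) (n : ℕ) : ContDiff ℝ 1 (layerCutoff ρ n) :=
  (Real.smoothTransition.contDiff (n := 1)).comp ((contDiff_const.mul hρ).sub contDiff_const)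

lemma contDiff_layerSlope (hρ : ContDiff ℝ 1 ρ) (n : ℕ) : ContDiff ℝ 1 (layerSlope ρ n) :=
  contDiff_const.mul
    (contDiff_deriv_smoothTransition.comp ((contDiff_const.mul hρ).sub contDiff_const))

lemma partialDeriv_comp_affine {f : ℝ → ℝ} (hf : Differentiable ℝ f) (hρ : ContDiff ℝ 1 ρ) (n : ℕ)
    (j : Fin 3) (x : E3) : partialDeriv j (fun y => f (-n * ρ y - 1)) x
      = deriv f (-n * ρ x - 1) * (-n * partialDeriv j ρ x) := by
  have d := hρ.differentiable (by norm_num) x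
  have d1 : DifferentiableAt ℝ (fun y => -n * ρ y - 1) x := (d.const_mul _).sub_const _
  rw [partialDeriv_comp (hf _) d1]
  congr 1
  rw [partialDeriv, fderiv_sub_const, fderiv_const_mul d]
  rfl

lemma partialDeriv_layerCutoff (hρ : ContDiff ℝ 1 ρ) (n : ℕ) (j : Fin 3) (x : E3) :
    partialDeriv j (layerCutoff ρ n) x = -layerSlope ρ n x * partialDeriv j ρ x := by
  have := partialDeriv_comp_affine ((Real.smoothTransition.contDiff (n := 1)).differentiable
    (by norm_num)) hρ n j x
  rw [show layerCutoff ρ n = fun y => Real.smoothTransition (-n * ρ y - 1) from rfl, this,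
    layerSlope]
  ring

lemma partialDeriv_layerSlope (hρ : ContDiff ℝ 1 ρ) (n : ℕ) (j : Fin 3) (x : E3) :
    partialDeriv j (layerSlope ρ n) x
      = -((n : ℝ) ^ 2 * deriv (deriv Real.smoothTransition) (-n * ρ x - 1))
        * partialDeriv j ρ x := by
  have hd := contDiff_deriv_smoothTransition.differentiable (by norm_num)
  have := partialDeriv_comp_affine hd hρ n j x
  have d1 : DifferentiableAt ℝ (fun y => deriv Real.smoothTransition (-n * ρ y - 1)) x :=
    (contDiff_deriv_smoothTransition.comp
      ((contDiff_const.mul hρ).sub contDiff_const)).differentiable (by norm_num) x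
  rw [show layerSlope ρ n = fun y => (n : ℝ) * deriv Real.smoothTransition (-n * ρ y - 1) from rfl,
    partialDeriv_mul (differentiableAt_const _) d1, this]
  simp [partialDeriv]
  ring

end LayerDerivatives

/-! ### Diamagnetic inequality, trace inequality and flux through the layers -/

section BoundaryEstimate

variable {B : ℝ} {A : E3 → E3} {u : Fin 3 → E3 → ℂ} {Ω : Set E3}

lemma contDiff_sqNorm (hu : ∀ k, ContDiff ℝ 1 (u k)) : ContDiff ℝ 1 (sqNorm u) :=
  ContDiff.sum fun k _ => (hu k).norm_sq ℝ

/-- The diamagnetic inequality for the derivative of `‖u‖ ^ 2`. -/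
lemma abs_partialDeriv_sqNorm_le (B : ℝ) (A : E3 → E3) (hu : ∀ k, ContDiff ℝ 1 (u k)) (l : Fin 3)
    (x : E3) : |partialDeriv l (sqNorm u) x| ≤ 6 * (√(sqNorm u x) * √(energy B A u x)) := by
  have du : ∀ k, DifferentiableAt ℝ (u k) x := fun k => (hu k).differentiable (by norm_num) x
  have e : ∀ k, partialDeriv l (fun y => ‖u k y‖ ^ 2) x
      = 2 * (Complex.I * conj (u k x) * magDeriv B A l (u k) x).re := by
    intro k
    have h1 : fderiv ℝ (fun y => ‖u k y‖ ^ 2) x = _ := (du k).hasFDerivAt.norm_sq.fderiv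
    rw [partialDeriv, h1]
    -- The potential contributes a purely imaginary term, so taking real parts replaces `∂_l` by
    -- `D_l` with no dependence on `A` in the bound.
    have h2 : Complex.I * conj (u k x) * magDeriv B A l (u k) x
        = conj (u k x) * partialDeriv l (u k) x
          + Complex.I * ((B * A x l * Complex.normSq (u k x) : ℝ) : ℂ) := by
      have := Complex.normSq_eq_conj_mul_self (z := u k x)
      simp only [magDeriv]
      push_cast
      rw [this]
      linear_combination (-conj (u k x) * partialDeriv l (u k) x) * Complex.I_sq
    rw [h2, Complex.add_re]
    simp [partialDeriv, Complex.inner]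
    ring
  have h2 : ∀ k, DifferentiableAt ℝ (fun y => ‖u k y‖ ^ 2) x := fun k => (du k).norm_sq ℝ
  have e' : partialDeriv l (sqNorm u) x = ∑ k, partialDeriv l (fun y => ‖u k y‖ ^ 2) x :=
    partialDeriv_sum (fun k _ => h2 k) l
  rw [e']
  calc _ ≤ ∑ k : Fin 3, 2 * (√(sqNorm u x) * √(energy B A u x)) := by
        refine (Finset.abs_sum_le_sum_abs _ _).trans (Finset.sum_le_sum fun k _ => ?_)
        rw [e, abs_mul, abs_two]
        gcongr
        refine (Complex.abs_re_le_norm _).trans ?_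
        rw [norm_mul, norm_mul, Complex.norm_I, one_mul, RCLike.norm_conj]
        gcongr
        · exact norm_le_sqrt_sqNorm k x
        · exact norm_magDeriv_le_sqrt_energy l k x
    _ = _ := by simp; ring

lemma norm_hessianForm_le {ρ : E3 → ℝ} {M : ℝ} {x : E3}
    (hM : ∀ j k, |partialDeriv k (partialDeriv j ρ) x| ≤ M) :
    ‖hessianForm ρ u x‖ ≤ 9 * M * sqNorm u x := by
  have hM0 : 0 ≤ M := (abs_nonneg _).trans (hM 0 0)
  have hs := Real.mul_self_sqrt (sqNorm_nonneg (u := u) x)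
  calc _ ≤ ∑ k : Fin 3, ∑ j : Fin 3, M * (√(sqNorm u x) * √(sqNorm u x)) := by
        refine norm_sum_le_of_le _ fun k _ => norm_sum_le_of_le _ fun j _ => ?_
        rw [norm_mul, norm_mul, RCLike.norm_conj, Complex.norm_real, Real.norm_eq_abs]
        have := hM j k
        have := norm_le_sqrt_sqNorm (u := u) k x
        have := norm_le_sqrt_sqNorm (u := u) j x
        gcongr
    _ = _ := by rw [hs]; simp; ring

lemma normalComponent_eq_zero_of_notMem_tsupport {ξ : E3 → ℝ} {x : E3} (hx : x ∉ tsupport ξ) :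
    normalComponent ξ u x = 0 :=
  Finset.sum_eq_zero fun j _ => by
    rw [partialDeriv_congr (show ξ =ᶠ[𝓝 x] fun _ => 0 from by
      filter_upwards [(isClosed_tsupport ξ).isOpen_compl.mem_nhds hx] with y hy
      exact image_eq_zero_of_notMem_tsupport hy)]
    simp [partialDeriv]

lemma hasCompactSupport_normalComponent {ξ : E3 → ℝ} (hc : HasCompactSupport ξ) :
    HasCompactSupport (normalComponent ξ u) :=
  hc.mono' fun _ hx => by
    by_contra hx'
    exact hx (normalComponent_eq_zero_of_notMem_tsupport hx')

namespace IsBoundaryChart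

variable {x₀ : E3} {r : ℝ} {ρ : E3 → ℝ} {l : Fin 3} {s c : ℝ}

/-- The trace inequality, with the surface measure replaced by layers. -/
lemma exists_abs_integral_layerSlope_le (hΩ : MeasurableSet Ω) (h : IsBoundaryChart Ω x₀ r ρ l s c)
    {b : E3 → ℝ} {M : ℝ} (hb : ContDiff ℝ 1 b) (hbs : tsupport b ⊆ Metric.ball x₀ (2 * r))
    (hM : ∀ x, |b x| ≤ M) (hM' : ∀ j x, |partialDeriv j b x| ≤ M) {δ : ℝ} (hδ : 0 < δ) :
    ∃ C : ℝ, ∀ (B : ℝ) (A : E3 → E3) (u : Fin 3 → E3 → ℂ) (X : E3 → ℝ) (n : ℕ),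
      IsAdmissible Ω A u X →
      |∫ x, layerSlope ρ n x * partialDeriv l ρ x * (X x ^ 2 * b x * sqNorm u x)|
        ≤ δ * (∫ x in Ω, X x ^ 2 * energy B A u x) + C * ∫ x in Ω, sqNorm u x := by
  have hM0 : 0 ≤ M := (abs_nonneg _).trans (hM 0)
  refine ⟨9 * M + (9 * M) ^ 2 / (4 * δ), fun B A u X n ha => ?_⟩
  have hXb : ContDiff ℝ 1 (fun x => X x ^ 2 * b x) :=
    ha.contDiff_sq_mul (by exact_mod_cast le_top) hb
  have hS := contDiff_sqNorm ha.contDiff_field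
  set V : E3 → ℝ := fun x => X x ^ 2 * b x * sqNorm u x with hV
  have Vs : ContDiff ℝ 1 V := hXb.mul hS
  have Vc : HasCompactSupport V := (ha.hasCompactSupport_sq_mul b).mul_right
  have cs := contDiff_layerCutoff h.contDiff_one n
  -- The derivative of the cutoff produces `layerSlope` times `∂_l ρ`, so this identity trades the
  -- layer integral for a volume integral of `∂_l V`.
  have zero := integral_partialDeriv_eq_zero (cs.mul Vs) Vc.mul_left l
  have e : ∀ x, partialDeriv l (fun y => layerCutoff ρ n y * V y) x
      = -(layerSlope ρ n x * partialDeriv l ρ x * V x) + layerCutoff ρ n x * partialDeriv l V x := by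
    intro x
    rw [partialDeriv_mul (cs.differentiable (by norm_num) x) (Vs.differentiable (by norm_num) x),
      partialDeriv_layerCutoff h.contDiff_one]
    ring
  have c1 := (contDiff_layerSlope h.contDiff_one n).continuous
  have c2 := continuous_partialDeriv h.contDiff_one l
  have c3 := continuous_partialDeriv Vs l
  have c4 := cs.continuous
  have c5 := Vs.continuous
  have i1 : Integrable (fun x => -(layerSlope ρ n x * partialDeriv l ρ x * V x)) :=
    (by fun_prop : Continuous _).integrable_of_hasCompactSupport Vc.mul_left.neg
  have i2 : Integrable (fun x => layerCutoff ρ n x * partialDeriv l V x) :=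
    (by fun_prop : Continuous _).integrable_of_hasCompactSupport
      (hasCompactSupport_partialDeriv Vc l).mul_left
  simp_rw [e] at zero
  rw [integral_add i1 i2, integral_neg, neg_add_eq_zero] at zero
  rw [zero]
  have e2 : ∫ x, layerCutoff ρ n x * partialDeriv l V x
      = ∫ x in Ω, layerCutoff ρ n x * partialDeriv l V x := by
    refine (setIntegral_eq_integral_of_forall_compl_eq_zero fun x hx => ?_).symm
    by_cases hxb : x ∈ Metric.ball x₀ (2 * r)
    · rw [layerCutoff_eq_zero (not_lt.1 fun h' => hx ((h.mem_iff x hxb).2 h')), zero_mul]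
    · have : V =ᶠ[𝓝 x] fun _ => 0 := by
        filter_upwards [(isClosed_tsupport b).isOpen_compl.mem_nhds fun h' => hxb (hbs h')]
          with y hy
        simp [hV, image_eq_zero_of_notMem_tsupport hy]
      rw [partialDeriv_congr this]
      simp [partialDeriv]
  rw [e2, ← Real.norm_eq_abs]
  refine norm_setIntegral_le_of_lowerOrder hΩ ha hδ fun x _ => ?_
  have hd : partialDeriv l V x = partialDeriv l (fun y => X y ^ 2 * b y) x * sqNorm u x
      + X x ^ 2 * b x * partialDeriv l (sqNorm u) x :=
    partialDeriv_mul (hXb.differentiable (by norm_num) x) (hS.differentiable (by norm_num) x) l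
  have h1 := ha.abs_partialDeriv_sq_mul_le (hb.differentiable (by norm_num) x) (hM x)
    (fun j => hM' j x) l
  have h2 := abs_partialDeriv_sqNorm_le B A ha.contDiff_field l x
  have h3 := ha.abs_cutoff_le x
  have hS0 := sqNorm_nonneg (u := u) x
  calc ‖layerCutoff ρ n x * partialDeriv l V x‖ ≤ 1 * |partialDeriv l V x| := by
        rw [norm_mul]
        gcongr
        · exact abs_layerCutoff_le n x
        · exact (Real.norm_eq_abs _).le
    _ ≤ |partialDeriv l (fun y => X y ^ 2 * b y) x| * sqNorm u x
        + |X x| * |X x| * |b x| * |partialDeriv l (sqNorm u) x| := by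
        rw [one_mul, hd]
        refine (abs_add_le _ _).trans ?_
        simp [abs_mul, pow_two, abs_of_nonneg hS0]
    _ ≤ 3 * M * 1 * sqNorm u x
        + |X x| * 1 * M * (6 * (√(sqNorm u x) * √(energy B A u x))) := by
        have hb := hM x
        gcongr
        exact h1.trans (by gcongr)
    _ ≤ 9 * M * (sqNorm u x + |X x| * (√(sqNorm u x) * √(energy B A u x))) := by
        have : 0 ≤ |X x| * (√(sqNorm u x) * √(energy B A u x)) := by positivity
        nlinarith [mul_nonneg hM0 hS0, mul_nonneg hM0 this]

/-- The flux of the field through the layers tends to zero, up to a curvature term. -/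
lemma tendsto_layer_flux (h : IsBoundaryChart Ω x₀ r ρ l s c) (hA : ContDiff ℝ 1 A)
    (hu : ∀ k, ContDiff ℝ 1 (u k)) (ht : IsTangential Ω u) {ξ : E3 → ℝ} (hξ : ContDiff ℝ 1 ξ)
    (hc : HasCompactSupport ξ) (hξs : tsupport ξ ⊆ Metric.ball x₀ r) :
    Tendsto (fun n : ℕ => (∫ x, ((-(ξ x * layerSlope ρ n x) : ℝ) : ℂ)
        * fluxForm B A u (fun j => partialDeriv j ρ x) x)
      - Complex.I * ∫ x, ((ξ x * layerSlope ρ n x : ℝ) : ℂ) * hessianForm ρ u x) atTop (𝓝 0) := by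
  have hρ := h.contDiff_one
  have hρ2 : ContDiff ℝ 2 ρ := by exact_mod_cast contDiff_infty.1 h.contDiff 2
  have hw := contDiff_normalComponent hρ2 hu
  have cu := fun k => (hu k).continuous
  have cξ := hξ.continuous
  have cρ := hρ.continuous
  have cw := hw.continuous
  have cd := continuous_magDivergence (B := B) hA.continuous hu
  have cH := continuous_hessianForm hρ2 hu
  have cn := continuous_normalComponent hξ cu
  have hcc := hasCompactSupport_ofReal hc
  have hcn : HasCompactSupport (normalComponent ξ u) := hasCompactSupport_normalComponent hc
  obtain ⟨C, hC0, hC⟩ := h.exists_norm_le_mul_abs hw fun x hx h0 =>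
    h.normalComponent_eq_zero ht hx h0
  set w := normalComponent ρ u
  set d := magDivergence B A u
  set f := Real.smoothTransition
  set H := hessianForm ρ u
  set P : E3 → ℂ := fun x => ξ x * d x - Complex.I * normalComponent ξ u x with hP
  set G₁ : E3 → ℂ := fun x => -(P x * conj (w x) - ξ x * w x * conj (d x)) with hG₁
  set G₂ : E3 → ℂ := fun x => -Complex.I * (ξ x * w x * conj (w x)) with hG₂
  have cP : Continuous P := by fun_prop
  have hPc : HasCompactSupport P := hcc.mul_right.sub hcn.mul_left
  have cG₁ : Continuous G₁ := by fun_prop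
  have cG₂ : Continuous G₂ := by fun_prop
  have hG₁c : HasCompactSupport G₁ := (hPc.mul_right.sub hcc.mul_right.mul_right).neg
  have hG₂c : HasCompactSupport G₂ := hcc.mul_right.mul_right.mul_left
  obtain ⟨N₁, hN₁⟩ := hPc.exists_bound_of_continuous cP
  obtain ⟨N₂, hN₂⟩ := (hcc.mul_right (f' := d)).exists_bound_of_continuous (by fun_prop)
  obtain ⟨N₃, hN₃⟩ := hcc.exists_bound_of_continuous (by fun_prop)
  have hξ0 : ∀ x ∉ Metric.ball x₀ r, ξ x = 0 := fun x hx =>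
    image_eq_zero_of_notMem_tsupport fun h' => hx (hξs h')
  have hξn0 : ∀ x ∉ Metric.ball x₀ r, normalComponent ξ u x = 0 := fun x hx =>
    normalComponent_eq_zero_of_notMem_tsupport fun h' => hx (hξs h')
  -- Terms linear in `w`: weight `n`, one order of vanishing.
  have L₁ := tendsto_integral_layer cρ (F := deriv f) contDiff_deriv_smoothTransition.continuous
    (fun t => deriv_smoothTransition_of_nonpos) (fun t => deriv_smoothTransition_of_one_le)
    cG₁ hG₁c (C := (N₁ + N₂) * C) (k := 1) (by
      intro x hx
      have hN1 := hN₁ x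
      have hN2 := hN₂ x
      by_cases hxb : x ∈ Metric.ball x₀ r
      · have hwx := hC x hxb hx
        calc ‖G₁ x‖ ≤ ‖P x * conj (w x)‖ + ‖ξ x * w x * conj (d x)‖ := by
              rw [hG₁]; simp only [norm_neg]; exact norm_sub_le _ _
          _ = ‖P x‖ * ‖w x‖ + ‖ξ x * d x‖ * ‖w x‖ := by
              simp only [norm_mul, RCLike.norm_conj]; ring
          _ ≤ N₁ * (C * |ρ x|) + N₂ * (C * |ρ x|) := by
              have := (norm_nonneg _).trans hN1
              have := (norm_nonneg _).trans hN2
              gcongr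
              exact hN2
          _ = _ := by ring
      · have := (norm_nonneg _).trans hN1
        have := (norm_nonneg _).trans hN2
        have : G₁ x = 0 := by simp [hG₁, hP, hξ0 x hxb, hξn0 x hxb]
        rw [this, norm_zero]
        positivity)
  -- Differentiating `layerSlope` once more gives weight `n ^ 2`, but its gradient is parallel to
  -- `∇ρ`, so a second factor `w` appears.
  have L₂ := tendsto_integral_layer cρ (F := deriv (deriv f))
    (contDiff_deriv_smoothTransition.continuous_deriv (by norm_num))
    (fun t ht => deriv_deriv_smoothTransition_of_deriv_eq_zero (deriv_smoothTransition_of_nonpos ht))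
    (fun t ht => deriv_deriv_smoothTransition_of_deriv_eq_zero
      (deriv_smoothTransition_of_one_le ht))
    cG₂ hG₂c (C := N₃ * C ^ 2) (k := 2) (by
      intro x hx
      have hN3 := hN₃ x
      by_cases hxb : x ∈ Metric.ball x₀ r
      · have hwx := hC x hxb hx
        calc ‖G₂ x‖ = ‖(ξ x : ℂ)‖ * ‖w x‖ ^ 2 := by
              simp only [hG₂, norm_mul, norm_neg, Complex.norm_I, RCLike.norm_conj]; ring
          _ ≤ N₃ * (C * |ρ x|) ^ 2 := by
              have := (norm_nonneg _).trans hN3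
              gcongr
          _ = _ := by ring
      · have := (norm_nonneg _).trans hN3
        have : G₂ x = 0 := by simp [hG₂, hξ0 x hxb]
        rw [this, norm_zero]
        positivity)
  have L := L₁.add L₂
  rw [add_zero] at L
  refine L.congr fun n => ?_
  have hS := contDiff_layerSlope hρ n
  have hη : ContDiff ℝ 1 (fun x => -(ξ x * layerSlope ρ n x)) := (hξ.mul hS).neg
  have hηc : HasCompactSupport (fun x => -(ξ x * layerSlope ρ n x)) := hc.mul_right.neg
  rw [integral_mul_fluxForm hA hρ2 hu hη hηc, ← integral_const_mul, ← integral_add, ← integral_sub]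
  · congr 1
    ext x
    have e : normalComponent (fun x => -(ξ x * layerSlope ρ n x)) u x
        = -(layerSlope ρ n x : ℂ) * normalComponent ξ u x
          + ξ x * ((n : ℝ) ^ 2 * deriv (deriv f) (-n * ρ x - 1) : ℝ) * w x := by
      have e1 : ∀ j, partialDeriv j (fun x => -(ξ x * layerSlope ρ n x)) x
          = -(partialDeriv j ξ x * layerSlope ρ n x) + ξ x * ((n : ℝ) ^ 2
            * deriv (deriv f) (-n * ρ x - 1)) * partialDeriv j ρ x := fun j => by
        have hn : partialDeriv j (fun x => -(ξ x * layerSlope ρ n x)) x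
            = -partialDeriv j (fun x => ξ x * layerSlope ρ n x) x := by
          simp [partialDeriv, fderiv_fun_neg]
        rw [hn, partialDeriv_mul (hξ.differentiable (by norm_num) x)
          (hS.differentiable (by norm_num) x), partialDeriv_layerSlope hρ]
        ring
      simp only [w, normalComponent, e1, Fin.sum_univ_three]
      push_cast
      ring
    rw [e]
    simp only [hG₁, hG₂, hP, layerSlope, pow_one, w, d, f, H]
    push_cast
    ring
  · have cη := hη.continuous
    have cnη := continuous_normalComponent hη cu
    have cS := hS.continuous
    have cd' : Continuous (magDivergence B A u) := cd
    have cw' : Continuous (normalComponent ρ u) := cw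
    have cH' : Continuous (hessianForm ρ u) := cH
    have hcη := hasCompactSupport_ofReal hηc
    have hcnη := hasCompactSupport_normalComponent (u := u) hηc
    exact (by fun_prop : Continuous _).integrable_of_hasCompactSupport
      (((hcη.mul_right.sub hcnη.mul_left).mul_right.sub hcη.mul_right.mul_right).sub
        hcη.mul_right.mul_left)
  · have cS := hS.continuous
    exact (by fun_prop : Continuous _).integrable_of_hasCompactSupport
      (hasCompactSupport_ofReal hc.mul_right).mul_right.mul_left
  · have := contDiff_deriv_smoothTransition.continuous
    exact (by fun_prop : Continuous _).integrable_of_hasCompactSupport hG₁c.mul_left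
  · have := contDiff_deriv_smoothTransition.continuous_deriv (by norm_num)
    exact (by fun_prop : Continuous _).integrable_of_hasCompactSupport hG₂c.mul_left

end IsBoundaryChart

end BoundaryEstimate

/-! ### Control of boundary weights and of the constant weight -/

section LocalControl

variable {B : ℝ} {A : E3 → E3} {u : Fin 3 → E3 → ℂ} {Ω : Set E3}

lemma exists_bound_partialDeriv {ζ : E3 → ℝ} (hζ : ContDiff ℝ 1 ζ) (hc : HasCompactSupport ζ) :
    ∃ M, (∀ x, |ζ x| ≤ M) ∧ ∀ j x, |partialDeriv j ζ x| ≤ M := by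
  obtain ⟨M₀, h₀⟩ := hc.exists_bound_of_continuous hζ.continuous
  obtain ⟨M₁, h₁⟩ := (hc.fderiv ℝ).exists_bound_of_continuous (hζ.continuous_fderiv (by norm_num))
  exact ⟨max M₀ M₁, fun x => (h₀ x).trans (le_max_left _ _), fun j x =>
    ((norm_partialDeriv_le ζ j x).trans (h₁ x)).trans (le_max_right _ _)⟩

namespace IsBoundaryChart

variable {x₀ : E3} {r : ℝ} {ρ : E3 → ℝ} {l : Fin 3} {s c : ℝ}

/-- The curvature term is of lower order. -/
lemma exists_norm_integral_hessianForm_le (hΩ : MeasurableSet Ω)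
    (h : IsBoundaryChart Ω x₀ r ρ l s c) {ζ : E3 → ℝ} {M : ℝ} (hM : ∀ x, |ζ x| ≤ M)
    (hζs : tsupport ζ ⊆ Metric.ball x₀ r) {δ : ℝ} (hδ : 0 < δ) :
    ∃ C : ℝ, ∀ (B : ℝ) (A : E3 → E3) (u : Fin 3 → E3 → ℂ) (X : E3 → ℝ) (n : ℕ),
      IsAdmissible Ω A u X →
      ‖∫ x, ((X x ^ 2 * ζ x * layerSlope ρ n x : ℝ) : ℂ) * hessianForm ρ u x‖
        ≤ δ * (∫ x in Ω, X x ^ 2 * energy B A u x) + C * ∫ x in Ω, sqNorm u x := by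
  have hr := h.radius_pos
  have hc := h.slope_pos
  have hM0 : 0 ≤ M := (abs_nonneg _).trans (hM 0)
  have hρ2 : ContDiff ℝ 2 ρ := by exact_mod_cast contDiff_infty.1 h.contDiff 2
  have hess := fun j k => continuous_partialDeriv
    (contDiff_partialDeriv (m := 1) hρ2 (by norm_num) j) k
  obtain ⟨M₂, hM₂⟩ := (isCompact_closedBall x₀ r).exists_bound_of_continuousOn
    (f := fun x (j : Fin 3) (k : Fin 3) => partialDeriv k (partialDeriv j ρ) x)
    (by fun_prop : Continuous _).continuousOn
  have hM₂' : ∀ x ∈ Metric.ball x₀ r, ∀ j k, |partialDeriv k (partialDeriv j ρ) x| ≤ M₂ :=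
    fun x hx j k => ((norm_le_pi_norm _ k).trans (norm_le_pi_norm
      (fun (j : Fin 3) (k : Fin 3) => partialDeriv k (partialDeriv j ρ) x) j)).trans
      (hM₂ x (Metric.ball_subset_closedBall hx))
  have hM₂0 : 0 ≤ M₂ := (abs_nonneg _).trans (hM₂' x₀ (Metric.mem_ball_self hr) 0 0)
  -- The weight `ζ` has no sign, whereas the trace inequality bounds the integral rather than the
  -- integral of the absolute value. Since `b` is nonnegative and equals 1 where `ζ` lives, and `s *
  -- ∂_l ρ ≥ c`, the Hessian term is dominated pointwise by a nonnegative integrand to which that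
  -- inequality applies.
  let b : ContDiffBump x₀ := ⟨r, 3 / 2 * r, hr, by linarith⟩
  have bs : ContDiff ℝ 1 b := b.contDiff
  have hbs : tsupport b ⊆ Metric.ball x₀ (2 * r) := by
    rw [b.tsupport_eq]
    exact Metric.closedBall_subset_ball (by change 3 / 2 * r < 2 * r; linarith)
  obtain ⟨Mb, hb, hb'⟩ := exists_bound_partialDeriv bs b.hasCompactSupport
  set K := 9 * M₂ * M / c with hK
  have hK0 : 0 ≤ K := by positivity
  obtain ⟨C, hC⟩ := h.exists_abs_integral_layerSlope_le hΩ bs hbs hb hb'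
    -- The inequality is later multiplied by `K`, and `K / (K + 1) ≤ 1`; adding 1 also covers `K =
    -- 0`.
    (show 0 < δ / (K + 1) by positivity)
  refine ⟨K * C, fun B A u X n ha => ?_⟩
  have key := hC B A u X n ha
  have cS := (contDiff_layerSlope h.contDiff_one n).continuous
  have cd := continuous_partialDeriv h.contDiff_one l
  have cX := ha.contDiff_cutoff.continuous
  have cn := continuous_sqNorm ha.contDiff_field
  have cb := bs.continuous
  have hint : Integrable (fun x => K * s * (layerSlope ρ n x * partialDeriv l ρ x
      * (X x ^ 2 * b x * sqNorm u x))) :=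
    (by fun_prop : Continuous _).integrable_of_hasCompactSupport
      (ha.hasCompactSupport_sq_mul b).mul_right.mul_left.mul_left
  have hpt : ∀ x, ‖((X x ^ 2 * ζ x * layerSlope ρ n x : ℝ) : ℂ) * hessianForm ρ u x‖
      ≤ K * s * (layerSlope ρ n x * partialDeriv l ρ x * (X x ^ 2 * b x * sqNorm u x)) := by
    intro x
    have hS0 := layerSlope_nonneg (ρ := ρ) n x
    have hu0 := sqNorm_nonneg (u := u) x
    have hX0 := sq_nonneg (X x)
    rw [show K * s * (layerSlope ρ n x * partialDeriv l ρ x * (X x ^ 2 * b x * sqNorm u x))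
      = K * (X x ^ 2 * layerSlope ρ n x * sqNorm u x) * (b x * (s * partialDeriv l ρ x)) by ring]
    by_cases hx : x ∈ Metric.ball x₀ r
    · have hsl := h.le_slope x (Metric.ball_subset_ball (by linarith) hx)
      rw [b.one_of_mem_closedBall (Metric.ball_subset_closedBall hx), one_mul, norm_mul,
        Complex.norm_real, norm_mul, norm_mul, Real.norm_eq_abs, Real.norm_eq_abs, Real.norm_eq_abs,
        abs_of_nonneg hS0, abs_of_nonneg hX0]
      calc _ ≤ X x ^ 2 * M * layerSlope ρ n x * (9 * M₂ * sqNorm u x) := by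
            gcongr
            · exact hM x
            · exact norm_hessianForm_le (hM₂' x hx)
        _ = K * (X x ^ 2 * layerSlope ρ n x * sqNorm u x) * c := by
            rw [hK]; field_simp
        _ ≤ _ := by gcongr
    · rw [image_eq_zero_of_notMem_tsupport fun h' => hx (hζs h')]
      have : 0 ≤ b x * (s * partialDeriv l ρ x) := by
        by_cases hx2 : x ∈ Metric.ball x₀ (2 * r)
        · have := h.le_slope x hx2
          exact mul_nonneg b.nonneg (by linarith)
        · rw [image_eq_zero_of_notMem_tsupport fun h' => hx2 (hbs h'), zero_mul]
      simp only [mul_zero, zero_mul, Complex.ofReal_zero, norm_zero]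
      positivity
  have hE : 0 ≤ ∫ x in Ω, X x ^ 2 * energy B A u x :=
    setIntegral_nonneg hΩ fun x _ => mul_nonneg (sq_nonneg _) (energy_nonneg x)
  calc _ ≤ K * s * ∫ x, layerSlope ρ n x * partialDeriv l ρ x * (X x ^ 2 * b x * sqNorm u x) := by
        rw [← integral_const_mul]
        exact norm_integral_le_of_norm_le hint (Eventually.of_forall hpt)
    _ ≤ K * |∫ x, layerSlope ρ n x * partialDeriv l ρ x * (X x ^ 2 * b x * sqNorm u x)| := by
        rw [mul_assoc]
        gcongr
        refine (le_abs_self _).trans ?_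
        rw [abs_mul, h.abs_sign, one_mul]
    _ ≤ K * (δ / (K + 1) * (∫ x in Ω, X x ^ 2 * energy B A u x) + C * ∫ x in Ω, sqNorm u x) := by
        gcongr
    _ = K / (K + 1) * (δ * ∫ x in Ω, X x ^ 2 * energy B A u x)
        + K * C * ∫ x in Ω, sqNorm u x := by ring
    _ ≤ _ := by
        exact add_le_add (mul_le_of_le_one_left (mul_nonneg hδ.le hE)
          ((div_le_one (by positivity)).2 (by linarith))) le_rfl

/-- Weights supported in a boundary chart are controlled. -/
lemma isControlled (hΩ : MeasurableSet Ω) (h : IsBoundaryChart Ω x₀ r ρ l s c) {ζ : E3 → ℝ}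
    (hζ : ContDiff ℝ ∞ ζ) (hζs : tsupport ζ ⊆ Metric.ball x₀ r) : IsControlled Ω ζ := by
  intro δ hδ
  have hζ1 : ContDiff ℝ 1 ζ := hζ.of_le (by exact_mod_cast le_top)
  have hζc : HasCompactSupport ζ := HasCompactSupport.intro (isCompact_closedBall x₀ r) fun x hx =>
    image_eq_zero_of_notMem_tsupport fun h' => hx (Metric.ball_subset_closedBall (hζs h'))
  obtain ⟨M, hM, hM'⟩ := exists_bound_partialDeriv hζ1 hζc
  have hM0 : 0 ≤ M := (abs_nonneg _).trans (hM 0)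
  obtain ⟨C, hC⟩ := h.exists_norm_integral_hessianForm_le hΩ hM hζs (half_pos hδ)
  refine ⟨54 * M + (54 * M) ^ 2 / (4 * (δ / 2)) + C, fun B A u X ha => ?_⟩
  have hA := ha.contDiff_potential
  have hu := ha.contDiff_field
  have hρ := h.contDiff_one
  set ξ : E3 → ℝ := fun x => X x ^ 2 * ζ x with hξ
  have ξs : ContDiff ℝ 1 ξ := ha.contDiff_sq_mul (by exact_mod_cast le_top) hζ1
  have ξc : HasCompactSupport ξ := ha.hasCompactSupport_sq_mul ζ
  have ξt : tsupport ξ ⊆ Metric.ball x₀ r :=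
    (tsupport_mul_subset_right (f := fun x : E3 => X x ^ 2) (g := ζ)).trans hζs
  have hcc := hasCompactSupport_ofReal ξc
  have cξ := ξs.continuous
  have cQ := continuous_totalNull (B := B) hA hu
  have hin : ∀ x ∈ Metric.ball x₀ r, (x ∈ Ω ↔ ρ x < 0) := fun x hx =>
    h.mem_iff x (Metric.ball_subset_ball (by linarith [h.radius_pos]) hx)
  have L₁ := tendsto_integral_cutoff hρ.continuous hΩ
    (G := fun x => (ξ x : ℂ) * totalNull B A u x) (by fun_prop) hcc.mul_right (fun x hx =>
      hin x (by
        by_contra hx'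
        exact hx (by simp [image_eq_zero_of_notMem_tsupport fun h' => hx' (ξt h')])))
  have L₂ := h.tendsto_layer_flux (B := B) hA hu ha.tangential ξs ξc ξt
  have L := L₁.norm.sub L₂.norm
  rw [norm_zero, sub_zero] at L
  -- It suffices to bound, uniformly in `n`, the cutoff integral minus the norm of the part of the
  -- flux that tends to zero.
  refine le_of_tendsto' L fun n => ?_
  have cc := contDiff_layerCutoff hρ n
  have cS := contDiff_layerSlope hρ n
  have hφ : ContDiff ℝ 1 (fun x => layerCutoff ρ n x * ξ x) := cc.mul ξs
  have hφc : HasCompactSupport (fun x => layerCutoff ρ n x * ξ x) := ξc.mul_left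
  have key := integral_mul_totalNull (B := B) hA hu hφ hφc
  have e1 : ∀ x j, partialDeriv j (fun x => layerCutoff ρ n x * ξ x) x
      = layerCutoff ρ n x * partialDeriv j ξ x
        + (-(ξ x * layerSlope ρ n x)) * partialDeriv j ρ x := fun x j => by
    rw [partialDeriv_mul (cc.differentiable (by norm_num) x) (ξs.differentiable (by norm_num) x),
      partialDeriv_layerCutoff hρ]
    ring
  have c1 := cc.continuous
  have c2 := cS.continuous
  have c3 := continuous_fluxForm (B := B) hA.continuous hu
    (p := fun x j => partialDeriv j ξ x) fun j => continuous_partialDeriv ξs j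
  have c4 := continuous_fluxForm (B := B) hA.continuous hu
    (p := fun x j => partialDeriv j ρ x) fun j => continuous_partialDeriv hρ j
  have hz : ∀ x ∉ tsupport ξ, ∀ j, partialDeriv j ξ x = 0 := fun x hx j => by
    rw [partialDeriv_congr (show ξ =ᶠ[𝓝 x] fun _ => 0 from by
      filter_upwards [(isClosed_tsupport ξ).isOpen_compl.mem_nhds hx] with y hy
      exact image_eq_zero_of_notMem_tsupport hy)]
    simp [partialDeriv]
  have hfc : HasCompactSupport (fun x => fluxForm B A u (fun j => partialDeriv j ξ x) x) :=
    HasCompactSupport.intro ξc.isCompact fun x hx => by simp [fluxForm, hz x hx]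
  have i1 : Integrable (fun x => (layerCutoff ρ n x : ℂ)
      * fluxForm B A u (fun j => partialDeriv j ξ x) x) :=
    (by fun_prop : Continuous _).integrable_of_hasCompactSupport hfc.mul_left
  have i2 : Integrable (fun x => ((-(ξ x * layerSlope ρ n x) : ℝ) : ℂ)
      * fluxForm B A u (fun j => partialDeriv j ρ x) x) :=
    (by fun_prop : Continuous _).integrable_of_hasCompactSupport
      (hasCompactSupport_ofReal ξc.mul_right.neg).mul_right
  simp only [e1, fluxForm_linear] at key
  rw [integral_add i1 i2] at key
  have e2 : ∫ x, (layerCutoff ρ n x : ℂ) * fluxForm B A u (fun j => partialDeriv j ξ x) x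
      = ∫ x in Ω, (layerCutoff ρ n x : ℂ) * fluxForm B A u (fun j => partialDeriv j ξ x) x := by
    refine (setIntegral_eq_integral_of_forall_compl_eq_zero fun x hx => ?_).symm
    by_cases hxb : x ∈ tsupport ξ
    · rw [layerCutoff_eq_zero (not_lt.1 fun h' => hx ((hin x (ξt hxb)).2 h'))]
      simp
    · simp [fluxForm, hz x hxb]
  have b1 : ‖∫ x in Ω, (layerCutoff ρ n x : ℂ) * fluxForm B A u (fun j => partialDeriv j ξ x) x‖
      ≤ δ / 2 * (∫ x in Ω, X x ^ 2 * energy B A u x)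
        + (54 * M + (54 * M) ^ 2 / (4 * (δ / 2))) * ∫ x in Ω, sqNorm u x := by
    refine norm_setIntegral_le_of_lowerOrder hΩ ha (half_pos hδ) fun x _ => ?_
    have hp : ∀ j, |partialDeriv j ξ x| ≤ 3 * M * |X x| := fun j =>
      ha.abs_partialDeriv_sq_mul_le (hζ1.differentiable (by norm_num) x) (hM x)
        (fun j => hM' j x) j
    have h1 := norm_fluxForm_le (B := B) (A := A) (u := u) hp x
    have h2 := abs_layerCutoff_le (ρ := ρ) n x
    have h3 := sqNorm_nonneg (u := u) x
    rw [norm_mul, Complex.norm_real, Real.norm_eq_abs]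
    calc _ ≤ 1 * (18 * (3 * M * |X x|) * (√(sqNorm u x) * √(energy B A u x))) := by gcongr
      _ ≤ _ := by nlinarith [mul_nonneg hM0 h3]
  have b2 := hC B A u X n ha
  have e3 : ∫ x, (Real.smoothTransition (-n * ρ x - 1) : ℂ) * ((ξ x : ℂ) * totalNull B A u x)
      = ∫ x, ((layerCutoff ρ n x * ξ x : ℝ) : ℂ) * totalNull B A u x := by
    congr 1
    ext x
    rw [layerCutoff]
    push_cast
    ring
  rw [e3, key, e2, norm_mul, Complex.norm_I, one_mul]
  set I₁ := ∫ x in Ω, (layerCutoff ρ n x : ℂ) * fluxForm B A u (fun j => partialDeriv j ξ x) x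
  set I₂ := ∫ x, ((-(ξ x * layerSlope ρ n x) : ℝ) : ℂ)
    * fluxForm B A u (fun j => partialDeriv j ρ x) x
  set I₃ := ∫ x, ((ξ x * layerSlope ρ n x : ℝ) : ℂ) * hessianForm ρ u x
  have tri : ‖I₁ + I₂‖ ≤ ‖I₁‖ + ‖I₂ - Complex.I * I₃‖ + ‖I₃‖ := by
    calc ‖I₁ + I₂‖ = ‖I₁ + (I₂ - Complex.I * I₃) + Complex.I * I₃‖ := by congr 1; ring
      _ ≤ ‖I₁‖ + ‖I₂ - Complex.I * I₃‖ + ‖Complex.I * I₃‖ := norm_add₃_le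
      _ = _ := by rw [norm_mul, Complex.norm_I, one_mul]
  linarith

end IsBoundaryChart

/-- The constant weight is controlled. -/
lemma isControlled_one (hΩ : IsSmoothDomain Ω) (hc : IsCompact (frontier Ω)) :
    IsControlled Ω (fun _ => 1) := by
  have hm := hΩ.isOpen.measurableSet
  obtain ⟨b, hb, hbc, hb1, hbC⟩ : ∃ b : E3 → ℝ, ContDiff ℝ ∞ b ∧ HasCompactSupport b ∧
      (∀ x ∈ frontier Ω, b =ᶠ[𝓝 x] 1) ∧
      ∀ g : E3 → ℝ, ContDiff ℝ ∞ g → IsControlled Ω (fun x => g x * b x) := by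
    -- Allowing an arbitrary smooth factor `g` is what makes unions work: `b + (1 - b) * b'` equals
    -- 1 near both sets, and its second summand is handled by the hypothesis for `b'` with factor `g
    -- * (1 - b)`.
    refine hc.induction_on (p := fun S => ∃ b : E3 → ℝ, ContDiff ℝ ∞ b ∧ HasCompactSupport b ∧
      (∀ x ∈ S, b =ᶠ[𝓝 x] 1) ∧
      ∀ g : E3 → ℝ, ContDiff ℝ ∞ g → IsControlled Ω (fun x => g x * b x)) ?_ ?_ ?_ ?_
    · refine ⟨0, contDiff_const, HasCompactSupport.zero, by simp, fun g _ δ _ => ⟨0, ?_⟩⟩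
      intro B A u X _
      have : 0 ≤ ∫ x in Ω, X x ^ 2 * energy B A u x :=
        setIntegral_nonneg hm fun x _ => mul_nonneg (sq_nonneg _) (energy_nonneg x)
      simp
      positivity
    · rintro S T hST ⟨b, h1, h2, h3, h4⟩
      exact ⟨b, h1, h2, fun x hx => h3 x (hST hx), h4⟩
    · rintro S T ⟨b, h1, h2, h3, h4⟩ ⟨b', h1', h2', h3', h4'⟩
      refine ⟨fun x => b x + (1 - b x) * b' x, h1.add ((contDiff_const.sub h1).mul h1'),
        h2.add h2'.mul_left, ?_, fun g hg => ?_⟩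
      · rintro x (hx | hx)
        · filter_upwards [h3 x hx] with y hy
          simp [hy]
        · filter_upwards [h3' x hx] with y hy
          simp [hy]
      · have hg' : ContDiff ℝ ∞ (fun x => g x * (1 - b x)) := hg.mul (contDiff_const.sub h1)
        have := (h4 g hg).add (hg.mul h1).continuous (hg'.mul h1').continuous (h4' _ hg')
        convert this using 2
        ring
    · intro x hx
      obtain ⟨r, ρ, l, s, c, h⟩ := exists_isBoundaryChart hΩ hx
      have hr := h.radius_pos
      let b : ContDiffBump x := ⟨r / 4, r / 2, by positivity, by linarith⟩
      refine ⟨Metric.ball x (r / 4), mem_nhdsWithin_of_mem_nhds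
        (Metric.ball_mem_nhds x (by positivity)), b, b.contDiff, b.hasCompactSupport, ?_, ?_⟩
      · intro y hy
        filter_upwards [Metric.isOpen_ball.mem_nhds hy] with z hz
        exact b.one_of_mem_closedBall (Metric.ball_subset_closedBall hz)
      · intro g hg
        refine h.isControlled hm (hg.mul b.contDiff) ?_
        refine (tsupport_mul_subset_right (f := g)).trans ?_
        rw [b.tsupport_eq]
        exact Metric.closedBall_subset_ball (by change r / 2 < r; linarith)
  have hb1' : ContDiff ℝ 1 b := hb.of_le (by exact_mod_cast le_top)
  obtain ⟨M, hM, hM'⟩ := exists_bound_partialDeriv hb1' hbc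
  have hs : ContDiff ℝ ∞ (fun x => 1 - b x) := contDiff_const.sub hb
  have hM0 : 0 ≤ M := (abs_nonneg _).trans (hM 0)
  -- The remainder `1 - b` vanishes near the whole boundary. Compact support of `b` bounds it and
  -- its gradient even when `Ω` is unbounded.
  have h1 := isControlled_of_eventually_eq_zero hΩ.isOpen hs (M := 1 + M)
    (fun x => (abs_sub _ _).trans (by rw [abs_one]; linarith [hM x])) (fun j x => by
      have : partialDeriv j (fun x => 1 - b x) x = -partialDeriv j b x := by
        simp [partialDeriv, fderiv_const_sub]
      rw [this, abs_neg]
      linarith [hM' j x]) (fun x hx => by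
      filter_upwards [hb1 x hx] with y hy
      simp [hy])
  have := h1.add hs.continuous hb.continuous (by simpa using hbC (fun _ => 1) contDiff_const)
  simpa using this

end LocalControl

/-! ### Pointwise algebra: covariant derivative against divergence and curl -/

section Pointwise

variable {A : E3 → E3}

lemma continuous_curl (hA : ContDiff ℝ 1 A) : Continuous (curl A) := by
  have h := fun j => continuous_partialDeriv hA j
  refine (PiLp.continuous_toLp 2 _).comp (continuous_pi fun i => ?_)
  fin_cases i <;> simp <;> fun_prop

lemma sum_sq_fieldTensor (B : ℝ) (A : E3 → E3) (x : E3) :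
    ∑ j, ∑ k, fieldTensor B A j k x ^ 2 = 2 * (B ^ 2 * ‖curl A x‖ ^ 2) := by
  simp only [EuclideanSpace.norm_sq_eq, Fin.sum_univ_three, curl, fieldTensor, Real.norm_eq_abs,
    sq_abs]
  simp
  ring

lemma abs_fieldTensor_le {B : ℝ} (hB : 0 ≤ B) (A : E3 → E3) (j k : Fin 3) (x : E3) :
    |fieldTensor B A j k x| ≤ B * ‖curl A x‖ := by
  have h := fun i => PiLp.norm_apply_le (curl A x) i
  have h0 := h 0
  have h1 := h 1
  have h2 := h 2
  simp only [curl, Real.norm_eq_abs] at h0 h1 h2 ⊢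
  simp only [fieldTensor, abs_mul, abs_of_nonneg hB]
  gcongr
  fin_cases j <;> fin_cases k <;>
    first
    | (simp; done)
    | simpa using h0
    | simpa using h1
    | simpa using h2
    | (rw [abs_sub_comm]; simpa using h0)
    | (rw [abs_sub_comm]; simpa using h1)
    | (rw [abs_sub_comm]; simpa using h2)

lemma norm_sum_fieldTensor_le {B : ℝ} (hB : 0 ≤ B) (A : E3 → E3) (u : Fin 3 → E3 → ℂ) (x : E3) :
    ‖∑ j, ∑ k, Complex.I * fieldTensor B A j k x * (u k x * conj (u j x))‖
      ≤ 9 * (B * ‖curl A x‖ * sqNorm u x) := by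
  have hs := Real.mul_self_sqrt (sqNorm_nonneg (u := u) x)
  calc _ ≤ ∑ j : Fin 3, ∑ k : Fin 3, B * ‖curl A x‖ * (√(sqNorm u x) * √(sqNorm u x)) := by
        refine norm_sum_le_of_le _ fun j _ => norm_sum_le_of_le _ fun k _ => ?_
        rw [norm_mul, norm_mul, norm_mul, RCLike.norm_conj, Complex.norm_real, Real.norm_eq_abs,
          Complex.norm_I, one_mul]
        have := abs_fieldTensor_le hB A j k x
        have := norm_le_sqrt_sqNorm (u := u) k x
        have := norm_le_sqrt_sqNorm (u := u) j x
        gcongr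
    _ = _ := by rw [hs]; simp; ring

/-- The algebraic identity between the full covariant derivative, the covariant divergence, the
covariant curl and the null forms. -/
lemma energy_eq (B : ℝ) (A : E3 → E3) (u : Fin 3 → E3 → ℂ) (x : E3) :
    energy B A u x
      = (∑ j, ∑ k, ‖magDeriv B A j (u k) x - magDeriv B A k (u j) x‖ ^ 2) / 2
        + ‖magDivergence B A u x‖ ^ 2 + (totalNull B A u x).re
        + (∑ j, ∑ k, Complex.I * fieldTensor B A j k x * (u k x * conj (u j x))).re := by
  simp only [energy, magDivergence, totalNull, nullForm, Fin.sum_univ_three, ← Complex.normSq_eq_norm_sq,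
    Complex.normSq_apply, Complex.add_re, Complex.sub_re, Complex.mul_re, Complex.add_im,
    Complex.sub_im, Complex.conj_re, Complex.conj_im]
  ring

/-- For a covariant gradient the antisymmetric part is the commutator, hence of order zero in `ψ`,
and the divergence is the magnetic Laplacian. The field is split as `β` plus its deviation, with |β|
= 1. -/
lemma energy_magDeriv_le {B : ℝ} (hB : 0 ≤ B) (hA : ContDiff ℝ 1 A) {ψ : E3 → ℂ}
    (hψ : ContDiff ℝ 2 ψ) (x : E3) :
    energy B A (fun k => magDeriv B A k ψ) x
      ≤ (2 * B ^ 2 * (‖curl A x - unitField‖ ^ 2 * ‖ψ x‖ ^ 2) + 2 * B ^ 2 * ‖ψ x‖ ^ 2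
          + ‖magLaplacian B A ψ x‖ ^ 2
          + 9 * B * (‖curl A x - unitField‖ * sqNorm (fun k => magDeriv B A k ψ) x)
          + 9 * B * sqNorm (fun k => magDeriv B A k ψ) x)
        + (totalNull B A (fun k => magDeriv B A k ψ) x).re := by
  set u : Fin 3 → E3 → ℂ := fun k => magDeriv B A k ψ with hu
  set κ := ‖curl A x - unitField‖ with hκ
  have hβ : ‖unitField‖ = 1 := by
    simp [unitField, EuclideanSpace.norm_eq, Fin.sum_univ_three]
  have hcurl : ‖curl A x‖ ≤ κ + 1 := by
    calc ‖curl A x‖ = ‖(curl A x - unitField) + unitField‖ := by rw [sub_add_cancel]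
      _ ≤ _ := (norm_add_le _ _).trans (by rw [hβ])
  have hcurl2 : ‖curl A x‖ ^ 2 ≤ 2 * κ ^ 2 + 2 := by
    have : ‖curl A x‖ ^ 2 ≤ (κ + 1) ^ 2 := by gcongr
    nlinarith [sq_nonneg (κ - 1)]
  have h1 : ∑ j, ∑ k, ‖magDeriv B A j (u k) x - magDeriv B A k (u j) x‖ ^ 2
      = 2 * (B ^ 2 * ‖curl A x‖ ^ 2) * ‖ψ x‖ ^ 2 := by
    rw [← sum_sq_fieldTensor, Finset.sum_mul]
    refine Finset.sum_congr rfl fun j _ => ?_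
    rw [Finset.sum_mul]
    refine Finset.sum_congr rfl fun k _ => ?_
    rw [hu, magDeriv_commutator hA hψ, norm_mul, norm_mul, norm_neg, Complex.norm_I, one_mul,
      mul_pow, Complex.norm_real, Real.norm_eq_abs, sq_abs]
  have h2 := (Complex.re_le_norm _).trans (norm_sum_fieldTensor_le hB A u x)
  have hS := sqNorm_nonneg (u := u) x
  have h3 : B * ‖curl A x‖ * sqNorm u x ≤ B * (κ + 1) * sqNorm u x := by gcongr
  have h4 : B ^ 2 * ‖curl A x‖ ^ 2 * ‖ψ x‖ ^ 2 ≤ B ^ 2 * (2 * κ ^ 2 + 2) * ‖ψ x‖ ^ 2 := by gcongr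
  have h5 : magDivergence B A u x = magLaplacian B A ψ x := rfl
  rw [energy_eq, h1, h5]
  linarith

end Pointwise

/-! ### Removal of the cutoff at infinity -/

section GlobalEstimate

/-- Dilates of one bump: the scale `n + 1 + M` exceeds the gradient bound `M`, so derivatives stay
below 1, and exceeds `n`, so the value is 1 on the ball of radius `n`. -/
lemma exists_cutoff_sequence : ∃ X : ℕ → E3 → ℝ, ∀ n, ContDiff ℝ ∞ (X n) ∧
    HasCompactSupport (X n) ∧ (∀ x, |X n x| ≤ 1) ∧ (∀ j x, |partialDeriv j (X n) x| ≤ 1) ∧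
    ∀ x : E3, ‖x‖ ≤ n → X n x = 1 := by
  obtain ⟨θ, hθ, θc, θ1, θle⟩ := exists_cutoff 1 one_pos
  obtain ⟨M, hM, hM'⟩ := exists_bound_partialDeriv (hθ.of_le (by exact_mod_cast le_top)) θc
  have hM0 : 0 ≤ M := (abs_nonneg _).trans (hM 0)
  refine ⟨fun n x => θ ((n + 1 + M : ℝ)⁻¹ • x), fun n => ?_⟩
  have ha : 0 < (n + 1 + M : ℝ) := by positivity
  refine ⟨hθ.comp (contDiff_const_smul _), θc.comp_smul (inv_ne_zero ha.ne'), fun x => θle _,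
    fun j x => ?_, fun x hx => ?_⟩
  · have e : partialDeriv j (fun x => θ ((n + 1 + M : ℝ)⁻¹ • x)) x
        = (n + 1 + M : ℝ)⁻¹ * partialDeriv j θ ((n + 1 + M : ℝ)⁻¹ • x) := by
      simp [partialDeriv, fderiv_comp_smul]
    rw [e, abs_mul, abs_of_pos (inv_pos.2 ha), inv_mul_le_iff₀ ha]
    have : (0 : ℝ) ≤ n := n.cast_nonneg
    linarith [hM' j ((n + 1 + M : ℝ)⁻¹ • x)]
  · apply θ1
    rw [mem_closedBall_zero_iff, norm_smul, norm_inv, Real.norm_of_nonneg ha.le,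
      inv_mul_le_iff₀ ha]
    linarith

/-- The passage from weighted estimates to the estimate on the whole domain. -/
lemma lintegral_energy_le {Ω : Set E3} (hΩ : IsSmoothDomain Ω) (hc : IsCompact (frontier Ω)) :
    ∃ C : ℝ, 0 ≤ C ∧ ∀ (B : ℝ) (A : E3 → E3) (u : Fin 3 → E3 → ℂ) (R : E3 → ℝ),
      ContDiff ℝ 1 A → (∀ k, ContDiff ℝ 1 (u k)) → IsTangential Ω u →
      IntegrableOn (sqNorm u) Ω → Continuous R → (∀ x, 0 ≤ R x) →
      (∀ x, energy B A u x ≤ R x + (totalNull B A u x).re) →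
      ∫⁻ x in Ω, ENNReal.ofReal (energy B A u x)
        ≤ 2 * (∫⁻ x in Ω, ENNReal.ofReal (R x))
          + ENNReal.ofReal C * ∫⁻ x in Ω, ENNReal.ofReal (sqNorm u x) := by
  have hm := hΩ.isOpen.measurableSet
  -- With `δ = 1 / 2` half of the weighted energy moves to the left, which is legitimate because
  -- compact support of the cutoff makes it finite; the resulting division by `1 / 2` doubles the
  -- other terms.
  obtain ⟨C₀, hC₀⟩ := isControlled_one hΩ hc (1 / 2) (by norm_num)
  refine ⟨2 * |C₀|, by positivity, fun B A u R hA hu ht hi cR hR0 hR => ?_⟩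
  obtain ⟨X, hX⟩ := exists_cutoff_sequence
  have cE := continuous_energy (B := B) hA hu
  have cQ := continuous_totalNull (B := B) hA hu
  have cX := fun n => (hX n).1.continuous
  have hS0 : 0 ≤ ∫ x in Ω, sqNorm u x := setIntegral_nonneg hm fun x _ => sqNorm_nonneg x
  have step : ∀ n, ∫⁻ x in Ω, ENNReal.ofReal (X n x ^ 2 * energy B A u x)
      ≤ 2 * (∫⁻ x in Ω, ENNReal.ofReal (R x))
          + ENNReal.ofReal (2 * |C₀|) * ∫⁻ x in Ω, ENNReal.ofReal (sqNorm u x) := by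
    intro n
    have ha : IsAdmissible Ω A u (X n) := ⟨hA, hu, ht, (hX n).1, (hX n).2.1, (hX n).2.2.1,
      (hX n).2.2.2.1, hi⟩
    have key := hC₀ B A u (X n) ha
    have cXn := cX n
    have i : ∀ {f : E3 → ℝ}, Continuous f → IntegrableOn (fun x => X n x ^ 2 * f x) Ω :=
      fun {f} hf => ((by fun_prop : Continuous _).integrable_of_hasCompactSupport
        (ha.hasCompactSupport_sq_mul f)).integrableOn
    have iQ : IntegrableOn (fun x => ((X n x ^ 2 * 1 : ℝ) : ℂ) * totalNull B A u x) Ω :=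
      ((by fun_prop : Continuous _).integrable_of_hasCompactSupport
        (hasCompactSupport_ofReal (ha.hasCompactSupport_sq_mul _)).mul_right).integrableOn
    have hre : ∫ x in Ω, X n x ^ 2 * (totalNull B A u x).re
        ≤ ‖∫ x in Ω, ((X n x ^ 2 * 1 : ℝ) : ℂ) * totalNull B A u x‖ := by
      refine le_trans (le_of_eq ?_) (Complex.re_le_norm _)
      have : ∫ x in Ω, (((X n x ^ 2 * 1 : ℝ) : ℂ) * totalNull B A u x).re
          = (∫ x in Ω, ((X n x ^ 2 * 1 : ℝ) : ℂ) * totalNull B A u x).re := integral_re iQ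
      rw [← this]
      congr 1
      ext x
      rw [Complex.re_ofReal_mul, mul_one]
    have h1 : ∫ x in Ω, X n x ^ 2 * energy B A u x ≤ (∫ x in Ω, X n x ^ 2 * R x)
        + ∫ x in Ω, X n x ^ 2 * (totalNull B A u x).re := by
      rw [← integral_add (i cR) (i (by fun_prop))]
      refine integral_mono (i cE) ((i cR).add (i (by fun_prop))) fun x => ?_
      rw [← mul_add]
      exact mul_le_mul_of_nonneg_left (hR x) (sq_nonneg _)
    have hC : C₀ * ∫ x in Ω, sqNorm u x ≤ |C₀| * ∫ x in Ω, sqNorm u x := by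
      gcongr
      exact le_abs_self _
    have h2 : ∫ x in Ω, X n x ^ 2 * energy B A u x
        ≤ 2 * (∫ x in Ω, X n x ^ 2 * R x) + 2 * |C₀| * ∫ x in Ω, sqNorm u x := by linarith
    have hXR0 : 0 ≤ ∫ x in Ω, X n x ^ 2 * R x :=
      setIntegral_nonneg hm fun x _ => mul_nonneg (sq_nonneg _) (hR0 x)
    rw [← ofReal_integral_eq_lintegral_ofReal (i cE)
      (Eventually.of_forall fun x => mul_nonneg (sq_nonneg _) (energy_nonneg x))]
    refine (ENNReal.ofReal_le_ofReal h2).trans ?_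
    rw [ENNReal.ofReal_add (by positivity) (by positivity), ENNReal.ofReal_mul (by norm_num),
      ENNReal.ofReal_mul (by positivity), ENNReal.ofReal_ofNat,
      ofReal_integral_eq_lintegral_ofReal (i cR)
        (Eventually.of_forall fun x => mul_nonneg (sq_nonneg _) (hR0 x)),
      ofReal_integral_eq_lintegral_ofReal hi (Eventually.of_forall fun x => sqNorm_nonneg x)]
    gcongr with x
    refine mul_le_of_le_one_left (hR0 x) ?_
    rw [← sq_abs]
    exact pow_le_one₀ (abs_nonneg _) ((hX n).2.2.1 x)
  have hlim : ∀ x, liminf (fun n => ENNReal.ofReal (X n x ^ 2 * energy B A u x)) atTop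
      = ENNReal.ofReal (energy B A u x) := by
    intro x
    refine Tendsto.liminf_eq (tendsto_const_nhds.congr' ?_)
    obtain ⟨N, hN⟩ := exists_nat_ge ‖x‖
    filter_upwards [eventually_ge_atTop N] with n hn
    rw [(hX n).2.2.2.2 x (hN.trans (by exact_mod_cast hn))]
    simp
  calc _ = ∫⁻ x in Ω, liminf (fun n => ENNReal.ofReal (X n x ^ 2 * energy B A u x)) atTop := by
        simp only [hlim]
    -- Fatou's lemma: the energy is not yet known to be integrable on `Ω`.
    _ ≤ liminf (fun n => ∫⁻ x in Ω, ENNReal.ofReal (X n x ^ 2 * energy B A u x)) atTop :=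
        lintegral_liminf_le fun n => by
          have := cX n
          exact (by fun_prop : Continuous fun x => X n x ^ 2 * energy B A u x).measurable.ennreal_ofReal
    _ ≤ _ := by
        refine liminf_le_of_le (by isBoundedDefault) fun b hb => ?_
        obtain ⟨n, hn⟩ := hb.exists
        exact hn.trans (step n)

end GlobalEstimate

/-! ### Hölder inequalities for the field deviation -/

section Norms

variable {F : Type*} [NormedAddCommGroup F] {Ω : Set E3}

lemma normLp_two_sq (f : E3 → F) :
    normLp Ω 2 f ^ 2 = ∫⁻ x in Ω, ENNReal.ofReal (‖f x‖ ^ 2) := by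
  have := eLpNorm_nnreal_pow_eq_lintegral (f := f) (μ := volume.restrict Ω) (p := 2) (by norm_num)
  simp only [NNReal.coe_ofNat, ENNReal.coe_ofNat, ENNReal.rpow_ofNat] at this
  rw [normLp, this]
  congr 1
  ext x
  rw [ENNReal.ofReal_pow (norm_nonneg _), ofReal_norm]

/-- Hölder for the product `κ f` in L², with 1/(2p) + 1/(2q) = 1/2. -/
lemma lintegral_mul_sq_le {κ : E3 → ℝ} {f : E3 → ℂ} {p q : ℝ≥0∞} (hκ : Continuous κ)
    (hf : Continuous f) (hpq : p⁻¹ + q⁻¹ = 1) :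
    ∫⁻ x in Ω, ENNReal.ofReal (κ x ^ 2 * ‖f x‖ ^ 2)
      ≤ normLp Ω (2 * p) κ ^ 2 * normLp Ω (2 * q) f ^ 2 := by
  have : ENNReal.HolderTriple (2 * p) (2 * q) 2 := ⟨by
    rw [ENNReal.mul_inv (by simp) (by simp), ENNReal.mul_inv (by simp) (by simp), ← mul_add, hpq,
      mul_one]⟩
  have h := eLpNorm_smul_le_mul_eLpNorm (p := 2 * p) (q := 2 * q) (r := 2)
    (μ := volume.restrict Ω) hf.aestronglyMeasurable hκ.aestronglyMeasurable
  have e : ∫⁻ x in Ω, ENNReal.ofReal (κ x ^ 2 * ‖f x‖ ^ 2) = normLp Ω 2 (κ • f) ^ 2 := by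
    rw [normLp_two_sq]
    congr 1
    ext x
    simp [mul_pow]
  rw [e, ← mul_pow]
  exact pow_le_pow_left' h 2

lemma lintegral_mul_norm_sq_le {κ : E3 → ℝ} (hκ0 : ∀ x, 0 ≤ κ x) {f : E3 → F} {p q : ℝ≥0∞}
    (hκ : Continuous κ) (hf : Continuous f) (hpq : p⁻¹ + q⁻¹ = 1) :
    ∫⁻ x in Ω, ENNReal.ofReal (κ x * ‖f x‖ ^ 2)
      ≤ normLp Ω p κ * normLp Ω (2 * q) f ^ 2 := by
  have : ENNReal.HolderTriple p q 1 := ⟨by simpa using hpq⟩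
  have h := eLpNorm_smul_le_mul_eLpNorm (p := p) (q := q) (r := 1) (μ := volume.restrict Ω)
    (f := fun x => ‖f x‖ ^ (2 : ℝ)) (φ := κ)
    (by fun_prop (disch := norm_num) : Continuous _).aestronglyMeasurable hκ.aestronglyMeasurable
  rw [eLpNorm_norm_rpow _ (by norm_num), eLpNorm_one_eq_lintegral_enorm] at h
  simp only [ENNReal.rpow_ofNat, ENNReal.ofReal_ofNat, mul_comm q] at h
  refine le_trans (le_of_eq ?_) h
  congr 1
  ext x
  rw [Pi.smul_apply', ← ofReal_norm, norm_smul, Real.norm_of_nonneg (hκ0 x)]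
  simp

end Norms

end MagneticNeumann

end

/-! ### The estimate -/

open MagneticNeumann

/-- `C^n(Ω̄)` is the space of restrictions to `Ω̄` of functions of class `C^n` on `ℝ³`; everything
below depends on `ψ` and `A` through their restrictions to `Ω̄` only. Both sides are in `[0, ∞]`. -/
theorem lemma2p3 (Ω : Set E3) (hΩ : IsSmoothDomain Ω) (hcpt : IsCompact (frontier Ω)) :
    ∃ C : ℝ, 0 < C ∧
      ∀ (B : ℝ) (A : E3 → E3) (p₁ q₁ p₂ q₂ : ℝ≥0∞) (ψ : E3 → ℂ),
        0 ≤ B → ContDiff ℝ 1 A →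
        1 ≤ p₁ → 1 ≤ p₂ → p₁⁻¹ + q₁⁻¹ = 1 → p₂⁻¹ + q₂⁻¹ = 1 →
        ContDiff ℝ ∞ ψ → MagneticNeumannCondition Ω B A ψ →
        ∑ j : Fin 3, ∑ k : Fin 3, normLp Ω 2 (magDeriv B A j (magDeriv B A k ψ)) ^ 2 ≤
          ENNReal.ofReal C *
            (ENNReal.ofReal (B ^ 2) * normLp Ω 2 ψ ^ 2
              + ENNReal.ofReal (1 + B) * normLp Ω 2 (magGrad B A ψ) ^ 2
              + normLp Ω 2 (magLaplacian B A ψ) ^ 2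
              + ENNReal.ofReal (B ^ 2) * normLp Ω (2 * p₁) (fun x => curl A x - unitField) ^ 2
                  * normLp Ω (2 * q₁) ψ ^ 2
              + ENNReal.ofReal B * normLp Ω p₂ (fun x => curl A x - unitField)
                  * normLp Ω (2 * q₂) (magGrad B A ψ) ^ 2) := by
  obtain ⟨C, hC0, hC⟩ := lintegral_energy_le hΩ hcpt
  -- The largest coefficient of the pointwise remainder is `9 * B`, doubled by the absorption; `C`
  -- multiplies only the squared L² norm of `𝐃ψ`.
  refine ⟨18 + C, by positivity, ?_⟩
  intro B A p₁ q₁ p₂ q₂ ψ hB hA _ _ hpq₁ hpq₂ hψ hN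
  have hψ2 : ContDiff ℝ 2 ψ := by exact_mod_cast contDiff_infty.1 hψ 2
  set u : Fin 3 → E3 → ℂ := fun k => magDeriv B A k ψ with hu
  have hu1 : ∀ k, ContDiff ℝ 1 (u k) := fun k => contDiff_magDeriv hA hψ2 k
  have hS : ∀ x, sqNorm u x = ‖magGrad B A ψ x‖ ^ 2 := fun x => by
    rw [EuclideanSpace.norm_sq_eq]
    rfl
  have cS := continuous_sqNorm hu1
  have cG : Continuous (magGrad B A ψ) :=
    (PiLp.continuous_toLp 2 _).comp (continuous_pi fun k => (hu1 k).continuous)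
  have cψ := hψ.continuous
  have cL : Continuous (magLaplacian B A ψ) := continuous_magDivergence (B := B) hA.continuous hu1
  have cκ : Continuous (fun x => ‖curl A x - unitField‖) :=
    ((continuous_curl hA).sub continuous_const).norm
  have hGS : ∫⁻ x in Ω, ENNReal.ofReal (sqNorm u x) = normLp Ω 2 (magGrad B A ψ) ^ 2 := by
    rw [normLp_two_sq]
    simp only [hS]
  -- If `𝐃ψ` is not square integrable the right side is infinite, since `1 + B > 0`; otherwise `u`
  -- meets the integrability condition of the weighted estimates.
  by_cases htop : ∫⁻ x in Ω, ENNReal.ofReal (sqNorm u x) = ⊤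
  · rw [← hGS, htop, ENNReal.mul_top (by simp; linarith)]
    simp only [add_top, top_add]
    rw [ENNReal.mul_top (by simp; linarith)]
    exact le_top
  have hi : IntegrableOn (sqNorm u) Ω := by
    refine ⟨cS.aestronglyMeasurable, ?_⟩
    rw [hasFiniteIntegral_iff_ofReal (Filter.Eventually.of_forall fun x => sqNorm_nonneg x)]
    exact lt_top_iff_ne_top.2 htop
  have ht : IsTangential Ω u := hN
  have hL : ∑ j : Fin 3, ∑ k : Fin 3, normLp Ω 2 (magDeriv B A j (magDeriv B A k ψ)) ^ 2
      = ∫⁻ x in Ω, ENNReal.ofReal (energy B A u x) := by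
    have hmeas : ∀ j k, Measurable fun x => ENNReal.ofReal (‖magDeriv B A j (u k) x‖ ^ 2) :=
      fun j k => ((continuous_magDeriv hA.continuous (hu1 k) j).norm.pow 2).measurable.ennreal_ofReal
    have e : ∀ x, ENNReal.ofReal (energy B A u x)
        = ∑ j, ∑ k, ENNReal.ofReal (‖magDeriv B A j (u k) x‖ ^ 2) := fun x => by
      rw [energy, ENNReal.ofReal_sum_of_nonneg fun j _ => by positivity]
      exact Finset.sum_congr rfl fun j _ => ENNReal.ofReal_sum_of_nonneg fun k _ => by positivity
    simp only [e, normLp_two_sq]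
    rw [lintegral_finsetSum _ fun j _ => Finset.measurable_sum _ fun k _ => hmeas j k]
    refine Finset.sum_congr rfl fun j _ => ?_
    rw [lintegral_finsetSum _ fun k _ => hmeas j k]
  set κ : E3 → ℝ := fun x => ‖curl A x - unitField‖ with hκ
  have hκ0 : ∀ x, 0 ≤ κ x := fun x => norm_nonneg _
  have hS0 : ∀ x, 0 ≤ sqNorm u x := fun x => sqNorm_nonneg x
  set R : E3 → ℝ := fun x => 2 * B ^ 2 * (κ x ^ 2 * ‖ψ x‖ ^ 2) + 2 * B ^ 2 * ‖ψ x‖ ^ 2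
          + ‖magLaplacian B A ψ x‖ ^ 2 + 9 * B * (κ x * sqNorm u x) + 9 * B * sqNorm u x with hR
  have cR : Continuous R := by fun_prop
  have hR0 : ∀ x, 0 ≤ R x := fun x => by
    have := hκ0 x
    have := hS0 x
    positivity
  have key := hC B A u R hA hu1 ht hi cR hR0 fun x => energy_magDeriv_le hB hA hψ2 x
  have hnκ : ∀ p, normLp Ω p κ = normLp Ω p (fun x => curl A x - unitField) := fun p =>
    eLpNorm_norm _
  have hH₁ := lintegral_mul_sq_le (Ω := Ω) cκ cψ hpq₁
  have hH₂ := lintegral_mul_norm_sq_le (Ω := Ω) hκ0 cκ cG hpq₂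
  rw [hnκ] at hH₁ hH₂
  simp only [← hS] at hH₂
  have hRint : ∫⁻ x in Ω, ENNReal.ofReal (R x)
      = 2 * ENNReal.ofReal (B ^ 2) * (∫⁻ x in Ω, ENNReal.ofReal (κ x ^ 2 * ‖ψ x‖ ^ 2))
        + 2 * ENNReal.ofReal (B ^ 2) * normLp Ω 2 ψ ^ 2 + normLp Ω 2 (magLaplacian B A ψ) ^ 2
        + 9 * ENNReal.ofReal B * (∫⁻ x in Ω, ENNReal.ofReal (κ x * sqNorm u x))
        + 9 * ENNReal.ofReal B * normLp Ω 2 (magGrad B A ψ) ^ 2 := by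
    have e : ∀ x, ENNReal.ofReal (R x)
        = 2 * ENNReal.ofReal (B ^ 2) * ENNReal.ofReal (κ x ^ 2 * ‖ψ x‖ ^ 2)
          + 2 * ENNReal.ofReal (B ^ 2) * ENNReal.ofReal (‖ψ x‖ ^ 2)
          + ENNReal.ofReal (‖magLaplacian B A ψ x‖ ^ 2)
          + 9 * ENNReal.ofReal B * ENNReal.ofReal (κ x * sqNorm u x)
          + 9 * ENNReal.ofReal B * ENNReal.ofReal (sqNorm u x) := fun x => by
      have := hκ0 x
      have := hS0 x
      rw [hR, ENNReal.ofReal_add (by positivity) (by positivity),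
        ENNReal.ofReal_add (by positivity) (by positivity),
        ENNReal.ofReal_add (by positivity) (by positivity),
        ENNReal.ofReal_add (by positivity) (by positivity),
        ENNReal.ofReal_mul (by positivity), ENNReal.ofReal_mul (by positivity),
        ENNReal.ofReal_mul (p := 2 * B ^ 2) (by positivity),
        ENNReal.ofReal_mul (p := 9 * B) (by positivity),
        ENNReal.ofReal_mul (p := 9 * B) (by positivity),
        ENNReal.ofReal_mul (p := 9) (by norm_num)]
      simp
    have m : ∀ {f : E3 → ℝ}, Continuous f → Measurable fun x => ENNReal.ofReal (f x) :=
      fun hf => hf.measurable.ennreal_ofReal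
    have m1 := m (f := fun x => κ x ^ 2 * ‖ψ x‖ ^ 2) (by fun_prop)
    have m2 := m (f := fun x => ‖ψ x‖ ^ 2) (by fun_prop)
    have m3 := m (f := fun x => ‖magLaplacian B A ψ x‖ ^ 2) (by fun_prop)
    have m4 := m (f := fun x => κ x * sqNorm u x) (by fun_prop)
    have m5 := m cS
    simp only [e]
    rw [lintegral_add_right _ (m5.const_mul _), lintegral_add_right _ (m4.const_mul _),
      lintegral_add_right _ m3, lintegral_add_right _ (m2.const_mul _),
      lintegral_const_mul _ m1, lintegral_const_mul _ m2, lintegral_const_mul _ m4,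
      lintegral_const_mul _ m5, normLp_two_sq, normLp_two_sq, ← hGS]
  rw [hL]
  refine key.trans ?_
  rw [hRint, hGS]
  have h18 : ENNReal.ofReal (18 + C) = 18 + ENNReal.ofReal C := by
    rw [ENNReal.ofReal_add (by norm_num) hC0]
    simp
  have h1B : ENNReal.ofReal (1 + B) = 1 + ENNReal.ofReal B := by
    rw [ENNReal.ofReal_add (by norm_num) hB]
    simp
  rw [h18, h1B]
  generalize ENNReal.ofReal C = c
  generalize ENNReal.ofReal B = β
  generalize ENNReal.ofReal (B ^ 2) = β₂
  generalize normLp Ω 2 ψ ^ 2 = a₁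
  generalize normLp Ω 2 (magGrad B A ψ) ^ 2 = a₂
  generalize normLp Ω 2 (magLaplacian B A ψ) ^ 2 = a₃
  rw [mul_assoc β₂, mul_assoc β]
  generalize hy₁ : normLp Ω (2 * p₁) (fun x => curl A x - unitField) ^ 2
    * normLp Ω (2 * q₁) ψ ^ 2 = y₁ at hH₁ ⊢
  generalize hy₂ : normLp Ω p₂ (fun x => curl A x - unitField)
    * normLp Ω (2 * q₂) (magGrad B A ψ) ^ 2 = y₂ at hH₂ ⊢
  calc _ ≤ 2 * (2 * β₂ * y₁ + 2 * β₂ * a₁ + a₃ + 9 * β * y₂ + 9 * β * a₂) + c * a₂ := by gcongr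
    _ = 4 * (β₂ * y₁) + 4 * (β₂ * a₁) + 2 * a₃ + 18 * (β * y₂) + 18 * (β * a₂) + c * a₂ := by ring
    _ ≤ (18 + c) * (β₂ * y₁) + (18 + c) * (β₂ * a₁) + (18 + c) * a₃ + (18 + c) * (β * y₂)
        + (18 + c) * (β * a₂) + (18 + c) * a₂ := by
        have h4 : (4 : ℝ≥0∞) ≤ 18 + c := le_add_right (by norm_num)
        have h2 : (2 : ℝ≥0∞) ≤ 18 + c := le_add_right (by norm_num)
        have h18 : (18 : ℝ≥0∞) ≤ 18 + c := le_add_right le_rfl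
        have hc : c ≤ 18 + c := le_add_left le_rfl
        gcongr
    _ = _ := by ring
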